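/- Let $X=\ell_1$ be the complex Banach space of absolutely summable sequences, let $\ell_1''$ be its bidual, and let $c_0^\perp\subset\ell_1''$ be the annihilator of $c_0\subset\ell_\infty=\ell_1'$. We regard $\ell_1\subset\ell_1''$ canonically. Let $\mathcal A_u(B_{\ell_1})$ be the Banach algebra of uniformly continuous holomorphic functions on the open unit ball $B_{\ell_1}$, with the supremum norm, and let $\mathcal M$ be its spectrum, that is, the set of nonzero multiplicative continuous linear functionals on it. For $z''$ in the closed unit ball of $\ell_1''$, the fiber over $z''$ is $\mathcal M_{z''}=\{\varphi\in\mathcal M:\ \varphi(y)=z''(y)\ \text{for all } y\in\ell_1'\}$. It contains the evaluation homomorphism $\delta_{z''}(f)=\widetilde f(z'')$, where $\widetilde f$ is the canonical (Aron–Berner) extension of $f$: on the open unit ball of $\ell_1''$ it is the sum of the Aron–Berner extensions of the Taylor polynomials of $f$ at $0$, and it is extended by continuity to the closed unit ball. The Gleason part of $\varphi\in\mathcal M$ is $\mathcal{GP}(\varphi)=\{\psi\in\mathcal M:\ \|\varphi-\psi\|<2\}$, with the norm of the dual of $\mathcal A_u(B_{\ell_1})$. **Proposition.** Let $z''\in\ell_1''$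 with $\|z''\|=1$ be of the form $z''=z+\omega$, where $z\in\ell_1$, $\|z\|<1$, and $\omega\in c_0^\perp$ is a real extreme point (an extreme point with respect to real line segments) of $\|\omega\|\,\overline B_{c_0^\perp}=\{w\in c_0^\perp:\ \|w\|\le\|\omega\|\}$. Then there is $\varphi\in\mathcal M_{z''}$ such that $\mathcal{GP}(\varphi)\neq\mathcal{GP}(\delta_{z''})$. -/

import Mathlib

open scoped BoundedContinuousFunction Pointwise Topology

noncomputable section

namespace AuSpectrum

section General

variable (X : Type*) [NormedAddCommGroup X] [NormedSpace ℂ X]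

/-- The algebra `𝒜_u(B_X)` of uniformly continuous holomorphic functions on the open unit ball
of `X`, with the supremum norm.  It is realised inside the bounded continuous functions on the
ball; this loses nothing, as a uniformly continuous function on the ball is bounded.
Holomorphic means locally given by a convergent series of continuous homogeneous polynomials. -/
def Au : Subalgebra ℂ (Metric.ball (0 : X) 1 →ᵇ ℂ) where
  carrier := {f | UniformContinuous f ∧
    AnalyticOnNhd ℂ (Function.extend Subtype.val f 0) (Metric.ball (0 : X) 1)}
  mul_mem' := by
    rintro f g ⟨hf, hf'⟩ ⟨hg, hg'⟩
    refine ⟨?_, ?_⟩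
    · have h := (((Metric.isBounded_closedBall (x := (0 : ℂ)) (r := ‖f‖)).prod
        (Metric.isBounded_closedBall (x := (0 : ℂ)) (r := ‖g‖))))
      have hmul : UniformContinuousOn (fun p : ℂ × ℂ => p.1 * p.2)
          (Metric.closedBall (0 : ℂ) ‖f‖ ×ˢ Metric.closedBall (0 : ℂ) ‖g‖) :=
        ((isCompact_closedBall _ _).prod
          (isCompact_closedBall _ _)).uniformContinuousOn_of_continuous (by fun_prop)
      have hpair : UniformContinuous fun x => (f x, g x) := hf.prodMk hg
      rw [← uniformContinuousOn_univ] at hpair ⊢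
      exact hmul.comp hpair fun x _ => by
        simpa using And.intro (f.norm_coe_le_norm x) (g.norm_coe_le_norm x)
    · refine (hf'.mul hg').congr Metric.isOpen_ball fun x hx => ?_
      have e : ∀ h : Metric.ball (0 : X) 1 → ℂ,
          Function.extend Subtype.val h 0 x = h ⟨x, hx⟩ := fun h =>
        Subtype.val_injective.extend_apply h 0 ⟨x, hx⟩
      simp [e]
  add_mem' := by
    rintro f g ⟨hf, hf'⟩ ⟨hg, hg'⟩
    refine ⟨hf.add hg, (hf'.add hg').congr Metric.isOpen_ball fun x hx => ?_⟩
    have e : ∀ h : Metric.ball (0 : X) 1 → ℂ,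
        Function.extend Subtype.val h 0 x = h ⟨x, hx⟩ := fun h =>
      Subtype.val_injective.extend_apply h 0 ⟨x, hx⟩
    simp [e]
  algebraMap_mem' := by
    intro c
    refine ⟨uniformContinuous_const (b := c), ?_⟩
    refine (analyticOnNhd_const (v := c)).congr Metric.isOpen_ball fun x hx => ?_
    have e : ∀ h : Metric.ball (0 : X) 1 → ℂ,
        Function.extend Subtype.val h 0 x = h ⟨x, hx⟩ := fun h =>
      Subtype.val_injective.extend_apply h 0 ⟨x, hx⟩
    rw [e]
    rfl

/-- The spectrum `𝓜(𝒜_u(B_X))`: the nonzero multiplicative continuous linear functionals. -/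
abbrev Spectrum : Type _ := WeakDual.characterSpace ℂ (Au X)

/-- The bidual `X''`. -/
abbrev Bidual : Type _ := StrongDual ℂ (StrongDual ℂ X)

variable {X}

/-- The restriction to the unit ball of a continuous linear functional, as an element of
`𝒜_u(B_X)`. -/
def ofDual (y : StrongDual ℂ X) : Au X :=
  ⟨BoundedContinuousFunction.ofNormedAddCommGroup (fun x : Metric.ball (0 : X) 1 => y x)
      (by fun_prop) ‖y‖ fun x => by
        have hx : ‖(x : X)‖ ≤ 1 := by
          have := x.2
          rw [mem_ball_zero_iff] at this
          exact this.le
        simpa using y.le_opNorm_of_le hx,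
    y.uniformContinuous.comp uniformContinuous_subtype_val, by
      refine (y.analyticOnNhd _).congr Metric.isOpen_ball fun x hx => ?_
      exact (Subtype.val_injective.extend_apply
        (fun x : Metric.ball (0 : X) 1 => y x) 0 ⟨x, hx⟩).symm⟩

/-- The fiber `𝓜_z` over a point `z` of the bidual: the homomorphisms whose restriction to `X'`
is `z`. -/
def fiber (z : Bidual X) : Set (Spectrum X) :=
  {φ | ∀ y : StrongDual ℂ X, φ (ofDual y) = z y}

/-- The Gleason part of `φ`: all `ψ` in the spectrum with `‖φ - ψ‖ < 2`, the norm being that of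
the dual of `𝒜_u(B_X)`. -/
def gleasonPart (φ : Spectrum X) : Set (Spectrum X) :=
  {ψ | ‖WeakDual.toStrongDual (φ : WeakDual ℂ (Au X)) -
    WeakDual.toStrongDual (ψ : WeakDual ℂ (Au X))‖ < 2}

/-- The value at `(z, …, z)` of the canonical (Aron--Berner) extension to the bidual of a
continuous `n`-linear form `A`, as a function of `A`.  Recursively it is
`z (x₁ ↦ z (x₂ ↦ ⋯ z (xₙ ↦ A (x₁, …, xₙ))))`, that is, the iterated limit
`lim_{α₁} ⋯ lim_{αₙ} A (x_{α₁}, …, x_{αₙ})` along any net `x_α` in `X` that converges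
weak-star to `z`. -/
def multilinearExtension (z : Bidual X) :
    (n : ℕ) → (ContinuousMultilinearMap ℂ (fun _ : Fin n => X) ℂ →L[ℂ] ℂ)
  | 0 => ((continuousMultilinearCurryFin0 ℂ X ℂ).toContinuousLinearEquiv : _ →L[ℂ] ℂ)
  | n + 1 =>
    z.comp
      (((ContinuousLinearMap.compL ℂ X
          (ContinuousMultilinearMap ℂ (fun _ : Fin n => X) ℂ) ℂ)
          (multilinearExtension z n)).comp
        ((continuousMultilinearCurryLeftEquiv ℂ
          (fun _ : Fin (n + 1) => X) ℂ).toContinuousLinearEquiv : _ →L[ℂ]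
            (X →L[ℂ] ContinuousMultilinearMap ℂ (fun _ : Fin n => X) ℂ)))

/-- The symmetric `n`-linear form `Dⁿf(0)/n!` of the `n`-th Taylor polynomial at `0`. -/
def taylorForm (f : Au X) (n : ℕ) : ContinuousMultilinearMap ℂ (fun _ : Fin n => X) ℂ :=
  (n.factorial : ℂ)⁻¹ •
    iteratedFDeriv ℂ n (Function.extend Subtype.val (f : Metric.ball (0 : X) 1 →ᵇ ℂ) 0) 0

/-- The canonical extension of `f ∈ 𝒜_u(B_X)` at a point `z` of the open unit ball of the bidual:
the sum at `z` of the extensions of the Taylor polynomials of `f` at `0`. -/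
def ballExtension (f : Au X) (z : Bidual X) : ℂ :=
  ∑' n : ℕ, multilinearExtension z n (taylorForm f n)

/-- The canonical extension `f̃` of `f ∈ 𝒜_u(B_X)` to the closed unit ball of the bidual.  On the
open ball it is uniformly continuous, and its continuous extension to the closed ball is given by
radial limits. -/
def canonicalExtension (f : Au X) (z : Bidual X) : ℂ :=
  Filter.limUnder (𝓝[<] (1 : ℝ)) fun r : ℝ => ballExtension f ((r : ℂ) • z)

end General

/-- The complex sequence space `ℓ₁`. -/
abbrev Ell1 : Type := lp (fun _ : ℕ => ℂ) 1

/-- The annihilator `c₀^⊥` of `c₀` in `ℓ₁''`.  Under `ℓ₁' = ℓ_∞` the functional `y` is the sequence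
`(y eₙ)ₙ`, so it lies in `c₀` when `y eₙ → 0`. -/
def c0Perp : Submodule ℂ (Bidual Ell1) where
  carrier := {ω | ∀ y : StrongDual ℂ Ell1,
    Filter.Tendsto (fun n : ℕ => y (lp.single 1 n (1 : ℂ))) Filter.atTop (𝓝 0) → ω y = 0}
  zero_mem' := fun _ _ => rfl
  add_mem' := by
    intro a b ha hb y hy
    simp [ha y hy, hb y hy]
  smul_mem' := by
    intro c a ha y hy
    simp [ha y hy]

end AuSpectrum

end

/-!
The points `z + c eₙ` lie in the closed unit ball of `ℓ₁`, and an ultrafilter on the indices turns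
them into an ultrafilter `p` on `ℓ₁` that converges weak-star to `z'' = z + ω`.  This rests on the
description of the real extreme points `ω` of the balls of `c₀^⊥`
(`exists_ultrafilter_of_extreme`): the norm of the bidual is additive over a set of indices and its
complement, so `ω` is carried by exactly one of the two; the sets that carry it form a free
ultrafilter `u`, and `ω y = c lim_u y eₙ` with `|c| = ‖ω‖ = 1 - ‖z‖`.

Two characters in the fiber over `z''` are obtained from `p`, both as radial limits
`f ↦ lim_{r → 1} lim_x f (r x)`.  For `φ` the inner limit is taken along `p` itself.  For `δ` it is
taken along the averages `(v₁ + ⋯ + vₖ) / k` of points that run one after the other through `p`,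
with `k → ∞` (a device of Davie and Gamelin).  In the expansion of a homogeneous polynomial of
degree `n` at such an average, the terms with a repeated vector are of lower order in `k`, and the
others have the Aron–Berner extension as iterated limit; hence `δ` is evaluation at `z''` of the
canonical extension (`tendsto_averageUltrafilter`, `IsRadialLimit.apply_eq_canonicalExtension`).
As a limit of evaluations it is multiplicative without further argument.

The characters differ on `∑ xᵢ²`: along `p` the diagonal contributes `c²`, along the averages
nothing.  The quadratic polynomials `testFunction` exploit this within the unit ball of the algebra.
Their values at `φ` tend to `(‖z‖ + ‖ω‖)² = 1`, and those at `δ` to `1 - ‖ω‖² < 1`.  After a high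
power and a polynomial that approximates a Möbius map of the disc, the values are close to `1` and
`-1` (`two_le_norm_sub`), so `‖φ - δ‖ ≥ 2`, and `φ` belongs to its own Gleason part but not to that
of `δ`.
-/

namespace AuSpectrum

open Filter

/-! ### Limits along ultrafilters -/

theorem exists_tendsto_ultrafilter_of_norm_le {α : Type*} (q : Ultrafilter α) {F : α → ℂ} {C : ℝ}
    (hF : ∀ᶠ x in q, ‖F x‖ ≤ C) : ∃ l, ‖l‖ ≤ C ∧ Tendsto F q (𝓝 l) := by
  have hmem : Metric.closedBall (0 : ℂ) C ∈ q.map F := by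
    change ∀ᶠ x in q, F x ∈ Metric.closedBall (0 : ℂ) C
    filter_upwards [hF] with x hx
    simpa using hx
  obtain ⟨l, hl, hle⟩ := (isCompact_closedBall (0 : ℂ) C).ultrafilter_le_nhds' (q.map F) hmem
  exact ⟨l, by simpa using hl, hle⟩

theorem tendsto_ultrafilter_bind {α β : Type*} {p : Ultrafilter α} {m : α → Ultrafilter β}
    {F : β → ℂ} {g : α → ℂ} {l : ℂ} (hm : ∀ᶠ a in p, Tendsto F (m a) (𝓝 (g a)))
    (hg : Tendsto g p (𝓝 l)) : Tendsto F (p.bind m) (𝓝 l) := by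
  rw [Metric.tendsto_nhds]
  intro ε hε
  change ∀ᶠ x in Filter.bind (p : Filter α) (fun a => (m a : Filter β)), dist (F x) l < ε
  rw [Filter.eventually_bind]
  filter_upwards [hm, Metric.tendsto_nhds.1 hg (ε / 2) (by positivity)] with a ha hga
  filter_upwards [Metric.tendsto_nhds.1 ha (ε / 2) (by positivity)] with x hx
  linarith [dist_triangle (F x) (g a) l]

theorem eventually_ultrafilter_bind {α β : Type*} {p : Ultrafilter α} {m : α → Ultrafilter β}
    {P : β → Prop} : (∀ᶠ x in p.bind m, P x) ↔ ∀ᶠ a in p, ∀ᶠ x in m a, P x :=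
  Filter.eventually_bind (f := (p : Filter α)) (m := fun a => (m a : Filter β))

/-! ### Characters given by ultrafilters -/

section General

variable {X : Type*} [NormedAddCommGroup X] [NormedSpace ℂ X]

/-- The extension by zero of `f ∈ 𝒜_u(B_X)` to the whole space. -/
noncomputable def zeroExtension (f : Au X) : X → ℂ :=
  Function.extend Subtype.val (f : Metric.ball (0 : X) 1 →ᵇ ℂ) 0

theorem zeroExtension_apply (f : Au X) {x : X} (hx : x ∈ Metric.ball (0 : X) 1) :
    zeroExtension f x = (f : Metric.ball (0 : X) 1 →ᵇ ℂ) ⟨x, hx⟩ :=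
  Subtype.val_injective.extend_apply _ _ (⟨x, hx⟩ : Metric.ball (0 : X) 1)

theorem norm_zeroExtension_le (f : Au X) (x : X) : ‖zeroExtension f x‖ ≤ ‖f‖ := by
  by_cases hx : x ∈ Metric.ball (0 : X) 1
  · rw [zeroExtension_apply f hx]
    exact (f : Metric.ball (0 : X) 1 →ᵇ ℂ).norm_coe_le_norm _
  · rw [zeroExtension, Function.extend_apply' _ _ _ (by rintro ⟨a, rfl⟩; exact hx a.2)]
    exact norm_zero.trans_le (norm_nonneg f)

theorem analyticOnNhd_zeroExtension (f : Au X) :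
    AnalyticOnNhd ℂ (zeroExtension f) (Metric.ball (0 : X) 1) := f.2.2

theorem zeroExtension_ofDual (y : StrongDual ℂ X) {x : X} (hx : x ∈ Metric.ball (0 : X) 1) :
    zeroExtension (ofDual y) x = y x :=
  zeroExtension_apply _ hx

/-- Every ultrafilter `q` on the open unit ball defines a character `f ↦ lim_q f`. -/
theorem exists_character_of_ultrafilter (q : Ultrafilter X)
    (hq : ∀ᶠ x in q, x ∈ Metric.ball (0 : X) 1) :
    ∃ χ : Spectrum X, ∀ f, Tendsto (zeroExtension f) q (𝓝 (χ f)) := by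
  have hex : ∀ f : Au X, ∃ l, ‖l‖ ≤ ‖f‖ ∧ Tendsto (zeroExtension f) q (𝓝 l) := fun f =>
    exists_tendsto_ultrafilter_of_norm_le q (Eventually.of_forall (norm_zeroExtension_le f))
  choose L hLn hL using hex
  have key : ∀ (f : Au X) (F : X → ℂ) (l : ℂ), Tendsto F q (𝓝 l) →
      (∀ x ∈ Metric.ball (0 : X) 1, zeroExtension f x = F x) → L f = l := by
    intro f F l hF hfF
    refine tendsto_nhds_unique (hL f) (hF.congr' ?_)
    filter_upwards [hq] with x hx
    exact (hfF x hx).symm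
  have hadd : ∀ f g, L (f + g) = L f + L g := fun f g =>
    key _ _ _ ((hL f).add (hL g)) fun x hx => by simp [zeroExtension_apply _ hx]
  have hmul : ∀ f g, L (f * g) = L f * L g := fun f g =>
    key _ _ _ ((hL f).mul (hL g)) fun x hx => by simp [zeroExtension_apply _ hx]
  have hsmul : ∀ (c : ℂ) f, L (c • f) = c • L f := fun c f =>
    key _ _ _ ((hL f).const_smul c) fun x hx => by simp [zeroExtension_apply _ hx]
  have hone : L 1 = 1 :=
    key _ _ _ tendsto_const_nhds fun x hx => by simp [zeroExtension_apply _ hx]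
  let Λ : StrongDual ℂ (Au X) :=
    LinearMap.mkContinuous { toFun := L, map_add' := hadd, map_smul' := hsmul } 1
      (fun f => by rw [one_mul]; exact hLn f)
  refine ⟨⟨StrongDual.toWeakDual Λ, ?_, hmul⟩, hL⟩
  intro h0
  have : Λ 1 = 0 := by
    exact congrArg (fun φ : WeakDual ℂ (Au X) => φ 1) h0
  rw [show Λ 1 = L 1 from rfl, hone] at this
  exact one_ne_zero this

/-! ### Taylor expansion on the ball -/

theorem contDiffOn_zeroExtension (f : Au X) {n : WithTop ℕ∞} :
    ContDiffOn ℂ n (zeroExtension f) (Metric.ball (0 : X) 1) :=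
  (analyticOnNhd_zeroExtension f).contDiffOn Metric.isOpen_ball.uniqueDiffOn

theorem taylorForm_comp_perm (f : Au X) (n : ℕ) (σ : Equiv.Perm (Fin n)) (v : Fin n → X) :
    taylorForm f n (v ∘ σ) = taylorForm f n v := by
  have h : ContDiffAt ℂ ⊤ (zeroExtension f) 0 :=
    (contDiffOn_zeroExtension f).contDiffAt (Metric.ball_mem_nhds _ one_pos)
  have := h.iteratedFDeriv_comp_perm v σ
  exact congrArg ((n.factorial : ℂ)⁻¹ * ·) this

theorem iteratedDeriv_zeroExtension_smul (f : Au X) (x : X) (n : ℕ) :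
    (n.factorial : ℂ)⁻¹ * iteratedDeriv n (fun ζ : ℂ => zeroExtension f (ζ • x)) 0 =
      taylorForm f n (fun _ => x) := by
  let g : ℂ →L[ℂ] X := ContinuousLinearMap.toSpanSingleton ℂ x
  have hopen : IsOpen (g ⁻¹' Metric.ball (0 : X) 1) := Metric.isOpen_ball.preimage g.continuous
  have h := g.iteratedFDerivWithin_comp_right (n := n) (x := 0) (contDiffOn_zeroExtension f)
    Metric.isOpen_ball.uniqueDiffOn hopen.uniqueDiffOn (by simp) (i := n) le_rfl
  rw [iteratedFDerivWithin_of_isOpen n hopen (by simp),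
    iteratedFDerivWithin_of_isOpen n Metric.isOpen_ball (by simp)] at h
  rw [iteratedDeriv_eq_iteratedFDeriv]
  change _ * iteratedFDeriv ℂ n (zeroExtension f ∘ g) 0 _ = _
  rw [h]
  simp [taylorForm, g, zeroExtension]

theorem smul_mem_ball {x : X} (hx : ‖x‖ ≤ 1) {ζ : ℂ} (hζ : ζ ∈ Metric.ball (0 : ℂ) 1) :
    ζ • x ∈ Metric.ball (0 : X) 1 := by
  rw [mem_ball_zero_iff] at hζ ⊢
  rw [norm_smul]
  nlinarith [norm_nonneg x, norm_nonneg ζ]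

theorem differentiableOn_zeroExtension_smul (f : Au X) {x : X} (hx : ‖x‖ ≤ 1) :
    DifferentiableOn ℂ (fun ζ : ℂ => zeroExtension f (ζ • x)) (Metric.ball (0 : ℂ) 1) := by
  refine (analyticOnNhd_zeroExtension f).differentiableOn.comp (by fun_prop) fun ζ hζ => ?_
  exact smul_mem_ball hx hζ

theorem hasSum_taylorForm (f : Au X) {x : X} (hx : ‖x‖ ≤ 1) {ζ : ℂ} (hζ : ‖ζ‖ < 1) :
    HasSum (fun n => ζ ^ n * taylorForm f n (fun _ => x)) (zeroExtension f (ζ • x)) := by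
  have h := Complex.hasSum_taylorSeries_on_ball (differentiableOn_zeroExtension_smul f hx)
    (z := ζ) (by simpa using hζ)
  refine h.congr_fun fun n => ?_
  rw [← iteratedDeriv_zeroExtension_smul f x]
  simp only [smul_eq_mul, sub_zero]
  ring

/-- Cauchy's estimate for the Taylor polynomials. -/
theorem norm_taylorForm_diag_le (f : Au X) {x : X} (hx : ‖x‖ ≤ 1) (n : ℕ) :
    ‖taylorForm f n (fun _ => x)‖ ≤ ‖f‖ := by
  have hbd := norm_zeroExtension_le f
  have hdiff := differentiableOn_zeroExtension_smul f hx
  rw [← iteratedDeriv_zeroExtension_smul f x]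
  generalize ‖f‖ = C at hbd ⊢
  set g : ℂ → ℂ := fun ζ : ℂ => zeroExtension f (ζ • x)
  have h : ∀ R ∈ Set.Ioo (0 : ℝ) 1,
      ‖(n.factorial : ℂ)⁻¹ * iteratedDeriv n g 0‖ ≤ C / R ^ n := by
    intro R hR
    have hcl : Metric.closedBall (0 : ℂ) R ⊆ Metric.ball 0 1 :=
      Metric.closedBall_subset_ball hR.2
    have := Complex.norm_iteratedDeriv_le_of_forall_mem_sphere_norm_le n hR.1
      ((hdiff.mono hcl).diffContOnCl_ball subset_rfl) (C := C) fun z _ => hbd _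
    rw [norm_mul, norm_inv, Complex.norm_natCast, inv_mul_le_iff₀ (by positivity),
      ← mul_div_assoc]
    exact this
  have ht : Tendsto (fun R : ℝ => C / R ^ n) (𝓝[<] 1) (𝓝 (C / 1 ^ n)) :=
    (ContinuousAt.div continuousAt_const (by fun_prop) (by simp)).tendsto.mono_left
      nhdsWithin_le_nhds
  rw [one_pow, div_one] at ht
  refine ge_of_tendsto ht ?_
  filter_upwards [Ioo_mem_nhdsLT (zero_lt_one (α := ℝ))] with R hR using h R hR

end General

section Averages

variable {X : Type*} [NormedAddCommGroup X]

/-! ### Iterated sums along an ultrafilter -/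

/-- The ultrafilter on `X` of the sums `v₁ + ⋯ + vₖ` whose terms run through `p`, the limit in `v₁`
being taken last. -/
def sumUltrafilter (p : Ultrafilter X) : ℕ → Ultrafilter X
  | 0 => pure 0
  | k + 1 => p.bind fun v => (sumUltrafilter p k).map fun x => v + x

theorem eventually_norm_le_sumUltrafilter {p : Ultrafilter X}
    (hp : ∀ᶠ x in (p : Filter X), ‖x‖ ≤ 1) (k : ℕ) : ∀ᶠ x in (sumUltrafilter p k : Filter X), ‖x‖ ≤ k := by
  induction k with
  | zero =>
    change ∀ᶠ x in pure (0 : X), _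
    simp
  | succ k ih =>
    rw [sumUltrafilter, eventually_ultrafilter_bind]
    filter_upwards [hp] with v hv
    rw [Ultrafilter.coe_map, eventually_map]
    filter_upwards [ih] with x hx
    push_cast
    linarith [norm_add_le v x]

variable [NormedSpace ℂ X]

/-! ### Symmetric multilinear forms -/

/-- A multilinear form is symmetric when permuting its arguments does not change its value. -/
def IsSymmetric {n : ℕ} (A : ContinuousMultilinearMap ℂ (fun _ : Fin n => X) ℂ) : Prop :=
  ∀ (σ : Equiv.Perm (Fin n)) (v : Fin n → X), A (v ∘ σ) = A v

theorem IsSymmetric.curryLeft {n : ℕ}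
    {A : ContinuousMultilinearMap ℂ (fun _ : Fin (n + 1) => X) ℂ} (hA : IsSymmetric A) (v : X) :
    IsSymmetric (A.curryLeft v) := by
  intro σ w
  have := hA (Equiv.Perm.decomposeFin.symm (0, σ)) (Fin.cons v w)
  rw [ContinuousMultilinearMap.curryLeft_apply, ContinuousMultilinearMap.curryLeft_apply, ← this]
  congr 1
  ext j
  refine Fin.cases ?_ (fun i => ?_) j <;> simp

theorem norm_curryLeft_apply_le {n : ℕ}
    (A : ContinuousMultilinearMap ℂ (fun _ : Fin (n + 1) => X) ℂ) {v : X} (hv : ‖v‖ ≤ 1) :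
    ‖A.curryLeft v‖ ≤ ‖A‖ := by
  have h := A.curryLeft.le_opNorm v
  rw [ContinuousMultilinearMap.curryLeft_norm] at h
  nlinarith [norm_nonneg A]

theorem IsSymmetric.apply_update {n : ℕ}
    {A : ContinuousMultilinearMap ℂ (fun _ : Fin (n + 1) => X) ℂ} (hA : IsSymmetric A) (v x : X)
    (i : Fin (n + 1)) :
    A (Function.update (fun _ => x) i v) = A.curryLeft v fun _ => x := by
  rw [ContinuousMultilinearMap.curryLeft_apply, ← hA (Equiv.swap 0 i) (Fin.cons v fun _ => x)]
  congr 1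
  ext j
  rcases eq_or_ne j i with rfl | hj
  · simp
  · have h0 : Equiv.swap 0 i j ≠ 0 := by
      intro h
      rw [Equiv.swap_apply_eq_iff, Equiv.swap_apply_left] at h
      exact hj h
    obtain ⟨l, hl⟩ := Fin.exists_succ_eq.2 h0
    simp [hj, ← hl]

/-- First order expansion of a homogeneous polynomial, the remainder being controlled by the
number of subsets of `Fin (n + 1)` with at least two elements: these are the choices of the
arguments that equal `v` in the terms of higher order. -/
theorem IsSymmetric.norm_apply_add_sub_le {n : ℕ}
    {A : ContinuousMultilinearMap ℂ (fun _ : Fin (n + 1) => X) ℂ} (hA : IsSymmetric A) {v x : X}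
    (hv : ‖v‖ ≤ 1) {k : ℕ} (hx : ‖x‖ ≤ k) :
    ‖A (fun _ => v + x) - A (fun _ => x) - (n + 1 : ℕ) * A.curryLeft v (fun _ => x)‖ ≤
      (Finset.univ.filter fun s : Finset (Fin (n + 1)) => 2 ≤ s.card).card *
        (‖A‖ * (k + 1 : ℝ) ^ (n - 1)) := by
  have h := A.toMultilinearMap.map_add_eq_map_add_linearDeriv_add (fun _ => x) (fun _ => v)
  have hfun : ((fun _ => x) + fun _ => v : Fin (n + 1) → X) = fun _ => v + x := by
    ext; simp [add_comm]
  rw [hfun, MultilinearMap.linearDeriv_apply] at h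
  simp only [ContinuousMultilinearMap.coe_coe, hA.apply_update, Finset.sum_const,
    Finset.card_univ, Fintype.card_fin, nsmul_eq_mul] at h
  rw [h, add_assoc, add_sub_cancel_left, add_sub_cancel_left]
  refine (norm_sum_le _ _).trans ?_
  rw [← nsmul_eq_mul]
  refine Finset.sum_le_card_nsmul _ _ _ fun s hs => ?_
  rw [Finset.mem_filter] at hs
  refine (A.le_opNorm _).trans (mul_le_mul_of_nonneg_left ?_ (norm_nonneg _))
  have hk : (1 : ℝ) ≤ k + 1 := by linarith [(Nat.cast_nonneg k : (0 : ℝ) ≤ k)]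
  calc ∏ i, ‖s.piecewise (fun _ => v) (fun _ => x) i‖
      ≤ ∏ i, if i ∈ s then (1 : ℝ) else k + 1 := by
        refine Finset.prod_le_prod (fun _ _ => norm_nonneg _) fun i _ => ?_
        by_cases hi : i ∈ s
        · simpa [hi] using hv
        · simp only [hi, not_false_eq_true, Finset.piecewise_eq_of_notMem, if_false]
          linarith
    _ = (k + 1 : ℝ) ^ (n + 1 - s.card) := by
        rw [Finset.prod_ite]
        simp only [Finset.prod_const_one, one_mul, Finset.prod_const]
        congr 1
        rw [Finset.filter_not, Finset.filter_mem_eq_inter, Finset.univ_inter,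
          Finset.card_univ_sdiff, Fintype.card_fin]
    _ ≤ (k + 1 : ℝ) ^ (n - 1) := pow_le_pow_right₀ hk (by omega)

/-! ### Extension to the bidual along an ultrafilter -/

/-- The ultrafilter on `X` of the averages `(v₁ + ⋯ + vₖ) / k`, as `k → ∞`. -/
noncomputable def averageUltrafilter (p : Ultrafilter X) : Ultrafilter X :=
  (hyperfilter ℕ).bind fun k => (sumUltrafilter p k).map fun x => (k : ℂ)⁻¹ • x

theorem eventually_norm_le_averageUltrafilter {p : Ultrafilter X}
    (hp : ∀ᶠ x in (p : Filter X), ‖x‖ ≤ 1) : ∀ᶠ x in (averageUltrafilter p : Filter X), ‖x‖ ≤ 1 := by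
  rw [averageUltrafilter, eventually_ultrafilter_bind]
  refine Eventually.of_forall fun k => ?_
  rw [Ultrafilter.coe_map, eventually_map]
  filter_upwards [eventually_norm_le_sumUltrafilter hp k] with x hx
  rw [norm_smul, norm_inv, Complex.norm_natCast]
  exact inv_mul_le_one_of_le₀ hx (Nat.cast_nonneg k)

theorem exists_tendsto_sumUltrafilter {p : Ultrafilter X} (hp : ∀ᶠ x in (p : Filter X), ‖x‖ ≤ 1) (k : ℕ)
    {n : ℕ} (A : ContinuousMultilinearMap ℂ (fun _ : Fin n => X) ℂ) :
    ∃ d, Tendsto (fun x => A fun _ => x) (sumUltrafilter p k) (𝓝 d) := by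
  obtain ⟨d, -, hd⟩ := exists_tendsto_ultrafilter_of_norm_le (sumUltrafilter p k)
    (F := fun x => A fun _ => x) (C := ‖A‖ * (k : ℝ) ^ n) (by
      filter_upwards [eventually_norm_le_sumUltrafilter hp k] with x hx
      refine (A.le_opNorm _).trans (mul_le_mul_of_nonneg_left ?_ (norm_nonneg _))
      simpa using pow_le_pow_left₀ (norm_nonneg x) hx n)
  exact ⟨d, hd⟩

/-- The extension to the bidual is computed by a limit in the first variable. -/
theorem tendsto_multilinearExtension_curryLeft {p : Ultrafilter X} {z : Bidual X}
    (hz : ∀ y : StrongDual ℂ X, Tendsto y p (𝓝 (z y))) {n : ℕ}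
    (A : ContinuousMultilinearMap ℂ (fun _ : Fin (n + 1) => X) ℂ) :
    Tendsto (fun v => multilinearExtension z n (A.curryLeft v)) p
      (𝓝 (multilinearExtension z (n + 1) A)) :=
  hz ((multilinearExtension z n).comp A.curryLeft)

/-- An injection into `k + 1` points either avoids the first point, or takes it exactly once. -/
theorem descFactorial_succ_add (k n : ℕ) :
    (k + 1).descFactorial (n + 1) = k.descFactorial (n + 1) + (n + 1) * k.descFactorial n := by
  rw [Nat.succ_descFactorial_succ, Nat.descFactorial_succ, ← add_mul]
  rcases le_or_gt n k with h | h
  · congr 1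
    omega
  · simp [Nat.descFactorial_of_lt h]

/-- On sums of `k` vectors the polynomial of a symmetric form `A` has a limit which differs from
the number of injections `Fin n → Fin k` times the extension of `A` by a term of lower order
in `k`. -/
theorem exists_norm_sub_descFactorial_le {p : Ultrafilter X} {z : Bidual X}
    (hp : ∀ᶠ x in (p : Filter X), ‖x‖ ≤ 1) (hz : ∀ y : StrongDual ℂ X, Tendsto y p (𝓝 (z y))) (n : ℕ) :
    ∃ C : ℝ, 0 ≤ C ∧ (n ≤ 1 → C = 0) ∧
      ∀ A : ContinuousMultilinearMap ℂ (fun _ : Fin n => X) ℂ, IsSymmetric A → ∀ (k : ℕ) (d : ℂ),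
        Tendsto (fun x => A fun _ => x) (sumUltrafilter p k) (𝓝 d) →
        ‖d - k.descFactorial n * multilinearExtension z n A‖ ≤ C * (‖A‖ * (k : ℝ) ^ (n - 1)) := by
  induction n with
  | zero =>
    refine ⟨0, le_rfl, fun _ => rfl, fun A _ k d hd => ?_⟩
    have hconst : (fun x : X => A fun _ => x) = fun _ => multilinearExtension z 0 A := by
      ext x
      exact congrArg A (Subsingleton.elim _ _)
    rw [hconst] at hd
    rw [tendsto_nhds_unique hd tendsto_const_nhds]
    simp
  | succ n ih =>
    obtain ⟨C, hC, hC0, ih⟩ := ih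
    set c : ℕ := (Finset.univ.filter fun s : Finset (Fin (n + 1)) => 2 ≤ s.card).card with hc
    -- The constant vanishes in degree one, where the exponent `n - 1` is truncated.
    have hc0 : n = 0 → c = 0 := by
      rintro rfl
      rw [hc, Finset.card_eq_zero, Finset.filter_eq_empty_iff]
      intro s _
      have := s.card_le_univ
      simp only [Nat.reduceAdd, Fintype.card_fin] at this
      omega
    set C' : ℝ := (n + 1) * C + c with hC'
    have hC'0 : n = 0 → C' = 0 := fun h => by
      rw [hC', hC0 (by omega), hc0 h]
      simp
    have hC'nn : 0 ≤ C' := by positivity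
    refine ⟨C', hC'nn, fun h => hC'0 (by omega), fun A hA k => ?_⟩
    -- The recursion of `descFactorial_succ_add` holds for the limits up to lower order.
    have hrec : ∀ (k : ℕ) (d e : ℂ),
        Tendsto (fun x => A fun _ => x) (sumUltrafilter p k) (𝓝 d) →
        Tendsto (fun x => A fun _ => x) (sumUltrafilter p (k + 1)) (𝓝 e) →
        ‖e - d - (n + 1 : ℕ) * (k.descFactorial n * multilinearExtension z (n + 1) A)‖ ≤
          C' * (‖A‖ * (k + 1 : ℝ) ^ (n - 1)) := by
      intro k d e hd he
      -- The first vector `v` is fixed, and the limit is taken in the remaining `k` ones.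
      have hex : ∀ v : X, ‖v‖ ≤ 1 → ∃ l,
          Tendsto (fun x => A fun _ => v + x) (sumUltrafilter p k) (𝓝 l) ∧
          ‖l - d - (n + 1 : ℕ) * (k.descFactorial n * multilinearExtension z n (A.curryLeft v))‖ ≤
            C' * (‖A‖ * (k + 1 : ℝ) ^ (n - 1)) := by
        intro v hv
        obtain ⟨b, hb⟩ := exists_tendsto_sumUltrafilter hp k (A.curryLeft v)
        obtain ⟨l, -, hl⟩ := exists_tendsto_ultrafilter_of_norm_le (sumUltrafilter p k)
          (F := fun x => A fun _ => v + x) (C := ‖A‖ * (1 + k : ℝ) ^ (n + 1)) (by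
            filter_upwards [eventually_norm_le_sumUltrafilter hp k] with x hx
            refine (A.le_opNorm _).trans (mul_le_mul_of_nonneg_left ?_ (norm_nonneg _))
            simpa using pow_le_pow_left₀ (norm_nonneg _)
              ((norm_add_le v x).trans (add_le_add hv hx)) (n + 1))
        refine ⟨l, hl, ?_⟩
        have h1 : ‖l - d - (n + 1 : ℕ) * b‖ ≤ c * (‖A‖ * (k + 1 : ℝ) ^ (n - 1)) := by
          refine le_of_tendsto ((hl.sub hd).sub (hb.const_mul _)).norm ?_
          filter_upwards [eventually_norm_le_sumUltrafilter hp k] with x hx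
          exact hA.norm_apply_add_sub_le hv hx
        have h2 : ‖b - k.descFactorial n * multilinearExtension z n (A.curryLeft v)‖ ≤
            C * (‖A‖ * (k + 1 : ℝ) ^ (n - 1)) := by
          refine (ih _ (hA.curryLeft v) k b hb).trans (mul_le_mul_of_nonneg_left ?_ hC)
          refine mul_le_mul (norm_curryLeft_apply_le A hv) ?_ (by positivity) (norm_nonneg _)
          exact pow_le_pow_left₀ (Nat.cast_nonneg k) (by linarith) _
        have h3 : ‖((n + 1 : ℕ) : ℂ) *
            (b - k.descFactorial n * multilinearExtension z n (A.curryLeft v))‖ ≤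
            (n + 1) * (C * (‖A‖ * (k + 1 : ℝ) ^ (n - 1))) := by
          rw [norm_mul, Complex.norm_natCast]
          push_cast
          exact mul_le_mul_of_nonneg_left h2 (by positivity)
        calc _ = ‖(l - d - (n + 1 : ℕ) * b) + ((n + 1 : ℕ) : ℂ) *
            (b - k.descFactorial n * multilinearExtension z n (A.curryLeft v))‖ := by
              congr 1; ring
          _ ≤ _ := norm_add_le _ _
          _ ≤ _ := add_le_add h1 h3
          _ = _ := by rw [hC']; ring
      -- The limit in `v` exists because the inner limits are bounded.
      choose! l hl hle using hex
      obtain ⟨e', -, he'⟩ := exists_tendsto_ultrafilter_of_norm_le p (F := l)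
        (C := C' * (‖A‖ * (k + 1 : ℝ) ^ (n - 1)) + ‖d‖ + ‖((n + 1 : ℕ) : ℂ) *
          k.descFactorial n‖ * (‖multilinearExtension z n‖ * ‖A‖)) (by
          filter_upwards [hp] with v hv
          have h1 := hle v hv
          have h2 : ‖((n + 1 : ℕ) : ℂ) *
              (k.descFactorial n * multilinearExtension z n (A.curryLeft v))‖ ≤
              ‖((n + 1 : ℕ) : ℂ) * k.descFactorial n‖ * (‖multilinearExtension z n‖ * ‖A‖) := by
            rw [← mul_assoc, norm_mul]
            refine mul_le_mul_of_nonneg_left ?_ (norm_nonneg _)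
            exact (multilinearExtension z n).le_opNorm_of_le (norm_curryLeft_apply_le A hv)
          have h3 := norm_le_insert' (l v - d)
            (((n + 1 : ℕ) : ℂ) * (k.descFactorial n * multilinearExtension z n (A.curryLeft v)))
          have h4 := norm_le_insert' (l v) d
          linarith)
      have hee : e = e' := by
        refine tendsto_nhds_unique he (tendsto_ultrafilter_bind ?_ he')
        filter_upwards [hp] with v hv
        rw [Ultrafilter.coe_map, tendsto_map'_iff]
        exact hl v hv
      subst hee
      refine le_of_tendsto ((he'.sub_const d).sub
        (((tendsto_multilinearExtension_curryLeft hz A).const_mul _).const_mul _)).norm ?_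
      filter_upwards [hp] with v hv using hle v hv
    have hbound : ∀ (k : ℕ) (d : ℂ),
        Tendsto (fun x => A fun _ => x) (sumUltrafilter p k) (𝓝 d) →
        ‖d - k.descFactorial (n + 1) * multilinearExtension z (n + 1) A‖ ≤
          C' * ‖A‖ * (k * (k : ℝ) ^ (n - 1)) := by
      intro k
      induction k with
      | zero =>
        intro d hd
        have h0 : Tendsto (fun x => A fun _ => x) (sumUltrafilter p 0) (𝓝 (A 0)) :=
          tendsto_pure_nhds (fun x => A fun _ => x) (0 : X)
        rw [tendsto_nhds_unique hd h0, A.map_zero]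
        simp
      | succ k ihk =>
        intro e he
        obtain ⟨d, hd⟩ := exists_tendsto_sumUltrafilter hp k A
        have h1 := ihk d hd
        have h2 := hrec k d e hd he
        calc ‖e - (k + 1).descFactorial (n + 1) * multilinearExtension z (n + 1) A‖
            = ‖(e - d - (n + 1 : ℕ) * (k.descFactorial n * multilinearExtension z (n + 1) A)) +
              (d - k.descFactorial (n + 1) * multilinearExtension z (n + 1) A)‖ := by
              rw [descFactorial_succ_add]
              congr 1
              push_cast
              ring
          _ ≤ _ := norm_add_le _ _
          _ ≤ C' * (‖A‖ * (k + 1 : ℝ) ^ (n - 1)) + C' * ‖A‖ * (k * (k + 1 : ℝ) ^ (n - 1)) := by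
              refine add_le_add h2 (h1.trans ?_)
              gcongr
              linarith
          _ = _ := by
              push_cast
              ring
    intro d hd
    refine (hbound k d hd).trans (le_of_eq ?_)
    rcases n with _ | n
    · rw [hC'0 rfl]
      ring
    · simp only [Nat.add_sub_cancel]
      ring

/-- Averaging suppresses the terms in which a vector is repeated: along the averages, the
polynomial of a symmetric form tends to its extension to the bidual. -/
theorem tendsto_averageUltrafilter {p : Ultrafilter X} {z : Bidual X}
    (hp : ∀ᶠ x in (p : Filter X), ‖x‖ ≤ 1) (hz : ∀ y : StrongDual ℂ X, Tendsto y p (𝓝 (z y))) {n : ℕ}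
    {A : ContinuousMultilinearMap ℂ (fun _ : Fin n => X) ℂ} (hA : IsSymmetric A) :
    Tendsto (fun x => A fun _ => x) (averageUltrafilter p) (𝓝 (multilinearExtension z n A)) := by
  obtain ⟨C, -, hC0, hC⟩ := exists_norm_sub_descFactorial_le hp hz n
  choose d hd using fun k => exists_tendsto_sumUltrafilter hp k A
  set M := multilinearExtension z n A
  refine tendsto_ultrafilter_bind (g := fun k : ℕ => ((k : ℂ)⁻¹) ^ n * d k) ?_ ?_
  · refine Eventually.of_forall fun k => ?_
    rw [Ultrafilter.coe_map, tendsto_map'_iff]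
    refine ((hd k).const_mul (((k : ℂ)⁻¹) ^ n)).congr fun x => ?_
    have := A.map_smul_univ (fun _ => (k : ℂ)⁻¹) (fun _ => x)
    simpa using this.symm
  · have hle : ((hyperfilter ℕ : Ultrafilter ℕ) : Filter ℕ) ≤ atTop := Nat.hyperfilter_le_atTop
    refine Tendsto.mono_left ?_ hle
    have h1 : Tendsto (fun k : ℕ => (((k.descFactorial n : ℝ) / (k : ℝ) ^ n : ℝ) : ℂ) * M) atTop
        (𝓝 M) := by
      have := (Asymptotics.isEquivalent_iff_tendsto_one (by
        filter_upwards [eventually_gt_atTop 0] with k hk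
        positivity)).1 (isEquivalent_descFactorial n)
      have h2 := ((Complex.continuous_ofReal.tendsto 1).comp this).mul_const M
      simpa [Function.comp_def] using h2
    have h2 : Tendsto (fun k : ℕ => ((k : ℂ)⁻¹) ^ n * d k -
        (((k.descFactorial n : ℝ) / (k : ℝ) ^ n : ℝ) : ℂ) * M) atTop (𝓝 0) := by
      refine squeeze_zero_norm' (a := fun k : ℕ => C * ‖A‖ * (k : ℝ)⁻¹) ?_ ?_
      · filter_upwards [eventually_gt_atTop 0] with k hk
        have hk' : (0 : ℝ) < k := by exact_mod_cast hk
        have h3 := hC A hA k (d k) (hd k)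
        have h4 : ((k : ℂ)⁻¹) ^ n * d k - (((k.descFactorial n : ℝ) / (k : ℝ) ^ n : ℝ) : ℂ) * M =
            ((k : ℂ)⁻¹) ^ n * (d k - k.descFactorial n * M) := by
          push_cast
          ring
        rw [h4, norm_mul, norm_pow, norm_inv, Complex.norm_natCast]
        rcases n with _ | n
        · rw [hC0 (by omega)] at h3 ⊢
          simpa using h3
        · refine (mul_le_mul_of_nonneg_left h3 (by positivity)).trans (le_of_eq ?_)
          simp only [Nat.add_sub_cancel, inv_pow]
          field_simp
          ring
      · simpa using (tendsto_inv_atTop_nhds_zero_nat (𝕜 := ℝ)).const_mul (C * ‖A‖)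
    simpa using h2.add h1

end Averages

section Canonical

variable {X : Type*} [NormedAddCommGroup X] [NormedSpace ℂ X]

/-! ### The canonical extension as a character -/

theorem multilinearExtension_smul (c : ℂ) (z : Bidual X) (n : ℕ) :
    multilinearExtension (c • z) n = c ^ n • multilinearExtension z n := by
  induction n with
  | zero => simp [multilinearExtension]
  | succ n ih =>
    ext A
    change (c • z) ((multilinearExtension (c • z) n).comp A.curryLeft) =
      c ^ (n + 1) * z ((multilinearExtension z n).comp A.curryLeft)
    rw [ih, ContinuousLinearMap.smul_comp, smul_apply, map_smul, smul_eq_mul, smul_eq_mul]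
    ring

/-- `q` converges to `z` on polynomials when, for every symmetric multilinear form, its values on
the diagonal tend along `q` to the canonical extension of the form at `z`. -/
def ConvergesOnPolynomials (q : Ultrafilter X) (z : Bidual X) : Prop :=
  ∀ (n : ℕ) (A : ContinuousMultilinearMap ℂ (fun _ : Fin n => X) ℂ), IsSymmetric A →
    Tendsto (fun x => A fun _ => x) q (𝓝 (multilinearExtension z n A))

theorem ConvergesOnPolynomials.tendsto_dual {q : Ultrafilter X} {z : Bidual X}
    (hqz : ConvergesOnPolynomials q z) (y : StrongDual ℂ X) : Tendsto y q (𝓝 (z y)) :=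
  hqz 1 ((continuousMultilinearCurryFin1 ℂ X ℂ).symm y) fun σ v => by
    rw [Subsingleton.elim σ 1]
    rfl

/-- The Taylor series converges uniformly on smaller balls, so that limits may be taken term by
term. -/
theorem ConvergesOnPolynomials.tendsto_ballExtension {q : Ultrafilter X} {z : Bidual X}
    (hq : ∀ᶠ x in (q : Filter X), ‖x‖ ≤ 1) (hqz : ConvergesOnPolynomials q z) (f : Au X) {r : ℝ}
    (hr : r ∈ Set.Ioo (0 : ℝ) 1) :
    Tendsto (fun x => zeroExtension f ((r : ℂ) • x)) q
      (𝓝 (ballExtension f ((r : ℂ) • z))) := by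
  have hr' : ‖(r : ℂ)‖ < 1 := by
    rw [Complex.norm_real, Real.norm_of_nonneg hr.1.le]
    exact hr.2
  have hbd : ∀ n (x : X), ‖x‖ ≤ 1 → ‖taylorForm f n fun _ => x‖ ≤ ‖f‖ := fun n x hx =>
    norm_taylorForm_diag_le f hx n
  have hsum : Summable fun n : ℕ => ‖(r : ℂ)‖ ^ n * ‖f‖ :=
    (summable_geometric_of_lt_one (norm_nonneg _) hr').mul_right _
  have h := tendsto_tsum_of_dominated_convergence (𝓕 := (q : Filter X))
    (f := fun x n => (r : ℂ) ^ n * taylorForm f n fun _ => x) hsum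
    (fun n => (hqz n (taylorForm f n) (taylorForm_comp_perm f n)).const_mul ((r : ℂ) ^ n)) (by
      filter_upwards [hq] with x hx n
      rw [norm_mul, norm_pow]
      exact mul_le_mul_of_nonneg_left (hbd n x hx) (by positivity))
  simp only [ballExtension, multilinearExtension_smul, smul_apply, smul_eq_mul]
  refine h.congr' ?_
  filter_upwards [hq] with x hx using (hasSum_taylorForm f hx hr').tsum_eq

/-- The radial limit that defines the canonical extension exists, by uniform continuity of `f`. -/
theorem ConvergesOnPolynomials.tendsto_canonicalExtension {q : Ultrafilter X} {z : Bidual X}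
    (hq : ∀ᶠ x in (q : Filter X), ‖x‖ ≤ 1) (hqz : ConvergesOnPolynomials q z) (f : Au X) :
    Tendsto (fun r : ℝ => ballExtension f ((r : ℂ) • z)) (𝓝[<] 1)
      (𝓝 (canonicalExtension f z)) := by
  refine tendsto_nhds_limUnder ?_
  rw [← cauchy_map_iff_exists_tendsto, Metric.cauchy_iff]
  refine ⟨inferInstance, fun ε hε => ?_⟩
  obtain ⟨η, hη, hf⟩ := Metric.uniformContinuous_iff.1 f.2.1 (ε / 2) (by positivity)
  refine ⟨_, image_mem_map (inter_mem (Ioo_mem_nhdsLT (zero_lt_one (α := ℝ)))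
    (Ioo_mem_nhdsLT (show 1 - η < 1 by linarith))), ?_⟩
  rintro _ ⟨r, ⟨hr, hrη⟩, rfl⟩ _ ⟨s, ⟨hs, hsη⟩, rfl⟩
  refine lt_of_le_of_lt ?_ (half_lt_self hε)
  refine le_of_tendsto ((hqz.tendsto_ballExtension hq f hr).dist
    (hqz.tendsto_ballExtension hq f hs)) ?_
  filter_upwards [hq] with x hx
  have hmem : ∀ t ∈ Set.Ioo (0 : ℝ) 1, (t : ℂ) • x ∈ Metric.ball (0 : X) 1 := fun t ht =>
    smul_mem_ball hx (by
      rw [mem_ball_zero_iff, Complex.norm_real, Real.norm_of_nonneg ht.1.le]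
      exact ht.2)
  rw [zeroExtension_apply f (hmem r hr), zeroExtension_apply f (hmem s hs)]
  refine (hf ?_).le
  rw [Subtype.dist_eq, dist_eq_norm, ← sub_smul, norm_smul, ← Complex.ofReal_sub,
    Complex.norm_real, Real.norm_eq_abs]
  have h1 : |r - s| < η := by
    rw [abs_lt]
    constructor <;> linarith [hrη.1, hrη.2, hsη.1, hsη.2]
  nlinarith [abs_nonneg (r - s), norm_nonneg x]

/-- A character is the radial limit of `p` when its value at `f` is
`lim_{r → 1} lim_{x → p} f (r x)` whenever these limits exist. -/
def IsRadialLimit (p : Ultrafilter X) (χ : Spectrum X) : Prop :=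
  ∀ (f : Au X) (B : ℝ → ℂ) (l : ℂ),
    (∀ r ∈ Set.Ioo (0 : ℝ) 1, Tendsto (fun x => zeroExtension f ((r : ℂ) • x)) p (𝓝 (B r))) →
    Tendsto B (𝓝[<] (1 : ℝ)) (𝓝 l) → χ f = l

/-- The ultrafilter `p` lives on the closed ball, where `f` need not be defined; its dilates by
`r < 1` live on the open ball. -/
theorem exists_isRadialLimit (p : Ultrafilter X) (hp : ∀ᶠ x in (p : Filter X), ‖x‖ ≤ 1) :
    ∃ χ : Spectrum X, IsRadialLimit p χ := by
  let U : Ultrafilter ℝ := Ultrafilter.of (𝓝[<] (1 : ℝ))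
  have hU : (U : Filter ℝ) ≤ 𝓝[<] (1 : ℝ) := Ultrafilter.of_le _
  have hr : ∀ᶠ r in U, r ∈ Set.Ioo (0 : ℝ) 1 := hU (Ioo_mem_nhdsLT zero_lt_one)
  let q : Ultrafilter X := U.bind fun r => p.map fun x => (r : ℂ) • x
  have hq : ∀ᶠ x in q, x ∈ Metric.ball (0 : X) 1 := by
    rw [eventually_ultrafilter_bind]
    filter_upwards [hr] with r hr
    rw [Ultrafilter.coe_map, eventually_map]
    filter_upwards [hp] with x hx
    refine smul_mem_ball hx ?_
    rw [mem_ball_zero_iff, Complex.norm_real, Real.norm_of_nonneg hr.1.le]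
    exact hr.2
  obtain ⟨χ, hχ⟩ := exists_character_of_ultrafilter q hq
  refine ⟨χ, fun f B l hB hl => tendsto_nhds_unique (hχ f) ?_⟩
  refine tendsto_ultrafilter_bind (g := B) ?_ (hl.mono_left hU)
  filter_upwards [hr] with r hr
  rw [Ultrafilter.coe_map, tendsto_map'_iff]
  exact hB r hr

theorem IsRadialLimit.apply_eq_canonicalExtension {q : Ultrafilter X} {z : Bidual X}
    {χ : Spectrum X} (hχ : IsRadialLimit q χ) (hq : ∀ᶠ x in (q : Filter X), ‖x‖ ≤ 1)
    (hqz : ConvergesOnPolynomials q z) (f : Au X) : χ f = canonicalExtension f z :=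
  hχ f _ _ (fun _ hr => hqz.tendsto_ballExtension hq f hr) (hqz.tendsto_canonicalExtension hq f)

/-- The radial limit of a function that agrees on the ball with an `n`-homogeneous function. -/
theorem IsRadialLimit.apply_eq_of_homogeneous {p : Ultrafilter X} {χ : Spectrum X}
    (hχ : IsRadialLimit p χ) (hp : ∀ᶠ x in (p : Filter X), ‖x‖ ≤ 1) {f : Au X} {P : X → ℂ} {n : ℕ}
    (hP : ∀ (c : ℂ) x, P (c • x) = c ^ n * P x)
    (hf : ∀ x ∈ Metric.ball (0 : X) 1, zeroExtension f x = P x) {l : ℂ}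
    (hl : Tendsto P p (𝓝 l)) : χ f = l := by
  refine hχ f (fun r => (r : ℂ) ^ n * l) l (fun r hr => ?_) ?_
  · refine (hl.const_mul ((r : ℂ) ^ n)).congr' ?_
    filter_upwards [hp] with x hx
    rw [hf _ (smul_mem_ball hx _), hP]
    rw [mem_ball_zero_iff, Complex.norm_real, Real.norm_of_nonneg hr.1.le]
    exact hr.2
  · have : Tendsto (fun r : ℝ => (r : ℂ) ^ n * l) (𝓝 1) (𝓝 (((1 : ℝ) : ℂ) ^ n * l)) :=
      Continuous.tendsto (by fun_prop) _
    simpa using this.mono_left nhdsWithin_le_nhds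

theorem IsRadialLimit.mem_fiber {p : Ultrafilter X} {χ : Spectrum X} {z : Bidual X}
    (hχ : IsRadialLimit p χ) (hp : ∀ᶠ x in (p : Filter X), ‖x‖ ≤ 1)
    (hz : ∀ y : StrongDual ℂ X, Tendsto y p (𝓝 (z y))) : χ ∈ fiber z := fun y =>
  hχ.apply_eq_of_homogeneous hp (n := 1) (by simp) (fun _ hx => zeroExtension_ofDual y hx) (hz y)

/-! ### Quadratic functions -/

/-- The restriction to the ball of the quadratic polynomial `x ↦ β x x` of a bilinear form, as an
element of `𝒜_u(B_X)`. -/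
noncomputable def ofBilin (β : X →L[ℂ] X →L[ℂ] ℂ) : Au X :=
  ⟨BoundedContinuousFunction.ofNormedAddCommGroup
      (fun x : Metric.ball (0 : X) 1 => β x x) (by fun_prop) ‖β‖ fun x => by
        have hx : ‖(x : X)‖ ≤ 1 := (mem_ball_zero_iff.1 x.2).le
        refine (β.le_opNorm₂ x x).trans ?_
        have h := norm_nonneg (x : X)
        have := mul_le_mul hx hx h zero_le_one
        nlinarith [norm_nonneg β],
    by
      have h : LipschitzWith (2 * ‖β‖₊) fun x : Metric.ball (0 : X) 1 => β x x := by
        refine LipschitzWith.of_dist_le_mul fun x y => ?_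
        have hx : ‖(x : X)‖ ≤ 1 := (mem_ball_zero_iff.1 x.2).le
        have hy : ‖(y : X)‖ ≤ 1 := (mem_ball_zero_iff.1 y.2).le
        rw [Subtype.dist_eq, dist_eq_norm, dist_eq_norm]
        have h1 : β x x - β y y = β (x - y) x + β y (x - y) := by
          simp
        rw [h1]
        refine (norm_add_le _ _).trans ?_
        have h2 := β.le_opNorm₂ ((x : X) - y) x
        have h3 := β.le_opNorm₂ (y : X) (x - y)
        have h4 : 0 ≤ ‖β‖ * ‖(x : X) - y‖ := by positivity
        push_cast
        nlinarith
      exact h.uniformContinuous, by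
      have h : AnalyticOnNhd ℂ (fun x : X => β x x) (Metric.ball (0 : X) 1) := fun x _ =>
        β.analyticAt_bilinear (x, x) |>.comp₂ analyticAt_id analyticAt_id
      refine h.congr Metric.isOpen_ball fun x hx => ?_
      exact (Subtype.val_injective.extend_apply
        (fun x : Metric.ball (0 : X) 1 => β x x) 0 ⟨x, hx⟩).symm⟩

theorem zeroExtension_ofBilin (β : X →L[ℂ] X →L[ℂ] ℂ) {x : X}
    (hx : x ∈ Metric.ball (0 : X) 1) : zeroExtension (ofBilin β) x = β x x :=
  zeroExtension_apply _ hx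

/-- A bilinear form as a multilinear form of degree two. -/
noncomputable def bilinForm (β : X →L[ℂ] X →L[ℂ] ℂ) :
    ContinuousMultilinearMap ℂ (fun _ : Fin 2 => X) ℂ :=
  ((((continuousMultilinearCurryFin1 ℂ X ℂ).symm.toContinuousLinearEquiv : (X →L[ℂ] ℂ) →L[ℂ]
    ContinuousMultilinearMap ℂ (fun _ : Fin 1 => X) ℂ)).comp β).uncurryLeft

theorem bilinForm_apply (β : X →L[ℂ] X →L[ℂ] ℂ) (v : Fin 2 → X) :
    bilinForm β v = β (v 0) (v 1) := rfl

theorem isSymmetric_bilinForm {β : X →L[ℂ] X →L[ℂ] ℂ} (hβ : ∀ x y, β x y = β y x) :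
    IsSymmetric (bilinForm β) := by
  intro σ v
  rw [bilinForm_apply, bilinForm_apply]
  have h01 : σ 0 = 0 ∧ σ 1 = 1 ∨ σ 0 = 1 ∧ σ 1 = 0 := by
    have : σ 0 ≠ σ 1 := fun h => by simpa using σ.injective h
    omega
  rcases h01 with h | h
  · simp [h]
  · simp [h, hβ (v 1)]

/-- The extension is `z (x ↦ z (y ↦ β x y))`. -/
theorem multilinearExtension_bilinForm (z : Bidual X) (β : X →L[ℂ] X →L[ℂ] ℂ) :
    multilinearExtension z 2 (bilinForm β) = z (z.comp β) := by
  rfl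

theorem IsRadialLimit.apply_ofBilin {p : Ultrafilter X} {χ : Spectrum X}
    (hχ : IsRadialLimit p χ) (hp : ∀ᶠ x in (p : Filter X), ‖x‖ ≤ 1) {β : X →L[ℂ] X →L[ℂ] ℂ} {l : ℂ}
    (hl : Tendsto (fun x => β x x) p (𝓝 l)) : χ (ofBilin β) = l :=
  hχ.apply_eq_of_homogeneous hp (n := 2) (fun c x => by simp; ring)
    (fun _ hx => zeroExtension_ofBilin β hx) hl

end Canonical

/-! ### A lower bound for the distance of two characters -/

/-- The Möbius map `w ↦ (w - s) / (1 - s w)` preserves the disc. -/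
theorem norm_sub_ofReal_le {w : ℂ} (hw : ‖w‖ ≤ 1) {s : ℝ} (h0 : 0 ≤ s) (h1 : s ≤ 1) :
    ‖w - s‖ ≤ ‖1 - s * w‖ := by
  rw [← sq_le_sq₀ (norm_nonneg _) (norm_nonneg _), Complex.sq_norm, Complex.sq_norm]
  have hw' : w.re * w.re + w.im * w.im ≤ 1 := by
    have := Complex.normSq_apply w ▸ Complex.sq_norm w
    nlinarith [norm_nonneg w]
  simp only [Complex.normSq_apply, Complex.sub_re, Complex.sub_im, Complex.mul_re, Complex.mul_im,
    Complex.ofReal_re, Complex.ofReal_im, Complex.one_re, Complex.one_im]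
  nlinarith [mul_nonneg (show 0 ≤ 1 - s * s by nlinarith) (sub_nonneg.2 hw')]

/-- A truncation of the power series of the Möbius map `w ↦ (w - s) / (1 - s w)`. -/
noncomputable def mobiusPoly {R : Type*} [Ring R] [Algebra ℂ R] (s : ℝ) (J : ℕ) (w : R) : R :=
  (w - algebraMap ℂ R s) * ∑ j ∈ Finset.range J, ((s : ℂ) • w) ^ j

theorem norm_mobiusPoly_le {w : ℂ} (hw : ‖w‖ ≤ 1) {s : ℝ} (h0 : 0 ≤ s) (h1 : s ≤ 1) (J : ℕ) :
    ‖mobiusPoly s J w‖ ≤ 1 + s ^ J := by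
  have h := mul_neg_geom_sum ((s : ℂ) * w) J
  calc ‖mobiusPoly s J w‖ = ‖w - s‖ * ‖∑ j ∈ Finset.range J, ((s : ℂ) * w) ^ j‖ := norm_mul _ _
    _ ≤ ‖1 - s * w‖ * ‖∑ j ∈ Finset.range J, ((s : ℂ) * w) ^ j‖ := by
        gcongr
        exact norm_sub_ofReal_le hw h0 h1
    _ = ‖1 - (s * w) ^ J‖ := by rw [← norm_mul, h]
    _ ≤ ‖(1 : ℂ)‖ + ‖((s : ℂ) * w) ^ J‖ := norm_sub_le _ _
    _ ≤ 1 + s ^ J := by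
        rw [norm_one, norm_pow, norm_mul, Complex.norm_real, Real.norm_of_nonneg h0]
        gcongr
        nlinarith [norm_nonneg w]

theorem mobiusPoly_one (s : ℝ) (J : ℕ) : mobiusPoly s J (1 : ℂ) = 1 - (s : ℂ) ^ J := by
  simpa [mobiusPoly] using mul_neg_geom_sum (s : ℂ) J

theorem mobiusPoly_zero (s : ℝ) (J : ℕ) : mobiusPoly s (J + 1) (0 : ℂ) = -s := by
  simp [mobiusPoly, Finset.sum_range_succ']

theorem continuous_mobiusPoly (s : ℝ) (J : ℕ) : Continuous (mobiusPoly s J : ℂ → ℂ) := by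
  unfold mobiusPoly
  fun_prop

section Distance

variable {X : Type*} [NormedAddCommGroup X] [NormedSpace ℂ X]

theorem mem_gleasonPart_self (φ : Spectrum X) : φ ∈ gleasonPart φ := by
  have h0 : WeakDual.toStrongDual (φ : WeakDual ℂ (Au X)) -
      WeakDual.toStrongDual (φ : WeakDual ℂ (Au X)) = 0 := by
    ext f
    simp
  change ‖_‖ < (2 : ℝ)
  rw [h0, ContinuousLinearMap.opNorm_zero]
  exact two_pos

theorem norm_le_of_forall_ball {f : Au X} {C : ℝ} (hC : 0 ≤ C)
    (h : ∀ x ∈ Metric.ball (0 : X) 1, ‖zeroExtension f x‖ ≤ C) : ‖f‖ ≤ C := by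
  refine (BoundedContinuousFunction.norm_le (f := (f : Metric.ball (0 : X) 1 →ᵇ ℂ)) hC).2
    fun x => ?_
  have := h x x.2
  rwa [zeroExtension_apply f x.2] at this

theorem zeroExtension_mobiusPoly (f : Au X) (k : ℕ) (s : ℝ) (J : ℕ) {x : X}
    (hx : x ∈ Metric.ball (0 : X) 1) :
    zeroExtension (mobiusPoly s J (f ^ k)) x = mobiusPoly s J (zeroExtension f x ^ k) := by
  rw [zeroExtension_apply _ hx, zeroExtension_apply _ hx]
  simp [mobiusPoly]

theorem norm_mobiusPoly_pow_le {f : Au X} (hf : ‖f‖ ≤ 1) (k : ℕ) {s : ℝ} (h0 : 0 ≤ s)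
    (h1 : s ≤ 1) (J : ℕ) : ‖mobiusPoly s J (f ^ k)‖ ≤ 1 + s ^ J := by
  refine norm_le_of_forall_ball (by positivity) fun x hx => ?_
  rw [zeroExtension_mobiusPoly f k s J hx]
  refine norm_mobiusPoly_le ?_ h0 h1 J
  rw [norm_pow]
  exact pow_le_one₀ (norm_nonneg _) ((norm_zeroExtension_le f x).trans hf)

theorem map_mobiusPoly (χ : Spectrum X) (s : ℝ) (J : ℕ) (f : Au X) :
    χ (mobiusPoly s J f) = mobiusPoly s J (χ f) := by
  simp only [mobiusPoly, map_mul, map_sub, map_sum, map_pow, map_smul, AlgHomClass.commutes]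

/-- Two characters are at distance at least two when functions of norm at most one have values that tend
to a point of the unit circle at one of them, and to a point of the open disc at the other. -/
theorem two_le_norm_sub {φ δ : Spectrum X} {f : ℕ → Au X} (hf : ∀ N, ‖f N‖ ≤ 1) {b : ℂ}
    (hb : ‖b‖ < 1) (hφ : Tendsto (fun N => φ (f N)) atTop (𝓝 1))
    (hδ : Tendsto (fun N => δ (f N)) atTop (𝓝 b)) :
    2 ≤ ‖WeakDual.toStrongDual (δ : WeakDual ℂ (Au X)) -
      WeakDual.toStrongDual (φ : WeakDual ℂ (Au X))‖ := by
  set T := WeakDual.toStrongDual (δ : WeakDual ℂ (Au X)) -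
      WeakDual.toStrongDual (φ : WeakDual ℂ (Au X))
  have hTapp : ∀ g, T g = δ g - φ g := fun g => rfl
  generalize hθ : ‖T‖ = θ
  -- The case of a fixed power and a fixed polynomial.
  have h1 : ∀ s ∈ Set.Ioo (0 : ℝ) 1, ∀ J k : ℕ,
      ‖mobiusPoly s J (1 : ℂ) - mobiusPoly s J (b ^ k)‖ ≤ θ * (1 + s ^ J) := by
    intro s hs J k
    have hc := continuous_mobiusPoly s J
    have hl := (((hc.tendsto _).comp (hφ.pow k)).sub ((hc.tendsto _).comp (hδ.pow k))).norm
    rw [one_pow] at hl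
    refine le_of_tendsto hl (Eventually.of_forall fun N => ?_)
    have h := T.le_opNorm_of_le (norm_mobiusPoly_pow_le (hf N) k hs.1.le hs.2.le J)
    rw [hTapp, map_mobiusPoly, map_mobiusPoly, map_pow, map_pow, hθ, norm_sub_rev] at h
    exact h
  -- High powers move the second value to the origin.
  have h2 : ∀ s ∈ Set.Ioo (0 : ℝ) 1, ∀ J : ℕ, 1 - s ^ (J + 1) + s ≤ θ * (1 + s ^ (J + 1)) := by
    intro s hs J
    have hc := continuous_mobiusPoly s (J + 1)
    have hl := (((hc.tendsto 0).comp (tendsto_pow_atTop_nhds_zero_of_norm_lt_one hb)).const_sub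
      (mobiusPoly s (J + 1) (1 : ℂ))).norm
    have h := le_of_tendsto hl (Eventually.of_forall fun k => h1 s hs (J + 1) k)
    rw [mobiusPoly_one, mobiusPoly_zero, sub_neg_eq_add] at h
    refine le_trans ?_ h
    refine le_trans (le_abs_self _) (le_of_eq ?_)
    rw [← Real.norm_eq_abs, ← Complex.norm_real]
    push_cast
    rfl
  -- The polynomials tend to the Möbius map as their degree grows.
  have h3 : ∀ s ∈ Set.Ioo (0 : ℝ) 1, 1 + s ≤ θ := by
    intro s hs
    have hp := (tendsto_pow_atTop_nhds_zero_of_lt_one hs.1.le hs.2).comp (tendsto_add_atTop_nat 1)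
    have h := le_of_tendsto_of_tendsto' ((hp.const_sub 1).add_const s)
      ((hp.const_add 1).const_mul θ) (h2 s hs)
    simpa using h
  by_contra! hlt
  rcases lt_or_ge θ 1 with h | h
  · linarith [h3 (1 / 2) (by norm_num)]
  · linarith [h3 (θ / 2) ⟨by linarith, by linarith⟩]

end Distance

/-! ### Operators and forms on `ℓ₁` -/

section Ell1

theorem summable_norm (x : Ell1) : Summable fun n => ‖x n‖ := by
  simpa using (lp.memℓp x).summable (by simp)

theorem norm_eq_tsum (x : Ell1) : ‖x‖ = ∑' n, ‖x n‖ := by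
  simp [lp.norm_eq_tsum_rpow (p := 1) (by simp)]

/-- The unit vectors of `ℓ₁`. -/
noncomputable abbrev e (n : ℕ) : Ell1 := lp.single 1 n (1 : ℂ)

theorem norm_e (n : ℕ) : ‖e n‖ = 1 := by
  simp

theorem norm_apply_e_le (y : StrongDual ℂ Ell1) (n : ℕ) : ‖y (e n)‖ ≤ ‖y‖ := by
  simpa [norm_e] using y.le_opNorm (e n)

/-- The norm of `ℓ₁' = ℓ_∞` is the supremum norm. -/
theorem opNorm_le_of_forall_e {y : StrongDual ℂ Ell1} {C : ℝ} (hC : 0 ≤ C)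
    (h : ∀ n, ‖y (e n)‖ ≤ C) : ‖y‖ ≤ C := by
  refine y.opNorm_le_bound hC fun x => ?_
  have hs : HasSum (fun n => y (lp.single 1 n (x n))) (y x) :=
    (lp.hasSum_single (by simp) x).mapL y
  have hb : ∀ n, ‖y (lp.single 1 n (x n))‖ ≤ C * ‖x n‖ := by
    intro n
    have : (lp.single 1 n (x n) : Ell1) = x n • e n := by
      rw [← lp.single_smul]
      simp
    rw [this, map_smul, norm_smul, mul_comm]
    gcongr
    exact h n
  rw [← hs.tsum_eq, norm_eq_tsum, ← tsum_mul_left]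
  exact tsum_of_norm_bounded ((summable_norm x).mul_left C).hasSum hb

/-- Summation of the coordinates. -/
noncomputable def total : StrongDual ℂ Ell1 := lp.tsumCLM ℂ ℕ ℂ

theorem total_apply (x : Ell1) : total x = ∑' n, x n := rfl

theorem norm_total_le (x : Ell1) : ‖total x‖ ≤ ‖x‖ := lp.norm_tsum_le x

theorem total_e (n : ℕ) : total (e n) = 1 := by
  rw [total_apply, tsum_eq_single n]
  · simp
  · intro m hm
    simp [hm]

/-- Multiplication by a sequence bounded by one. -/
noncomputable def diag (a : ℕ → ℂ) (ha : ∀ n, ‖a n‖ ≤ 1) : Ell1 →L[ℂ] Ell1 :=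
  lp.mapCLM 1 (fun n => a n • ContinuousLinearMap.id ℂ ℂ) zero_le_one fun n => by
    simpa [norm_smul] using ha n

theorem diag_apply (a : ℕ → ℂ) (ha : ∀ n, ‖a n‖ ≤ 1) (x : Ell1) (n : ℕ) :
    diag a ha x n = a n * x n := by
  simp [diag]

theorem norm_diag_le (a : ℕ → ℂ) (ha : ∀ n, ‖a n‖ ≤ 1) (x : Ell1) : ‖diag a ha x‖ ≤ ‖x‖ := by
  have h := ContinuousLinearMap.le_of_opNorm_le (diag a ha)
    (lp.norm_mapCLM_le 1 _ zero_le_one _) x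
  rwa [one_mul] at h

/-- Restriction of a sequence to a set of indices. -/
noncomputable def trunc (A : Set ℕ) : Ell1 →L[ℂ] Ell1 :=
  diag (A.indicator 1) fun n => by
    by_cases h : n ∈ A <;> simp [h]

theorem trunc_apply (A : Set ℕ) (x : Ell1) (n : ℕ) : trunc A x n = A.indicator x n := by
  rw [trunc, diag_apply]
  by_cases h : n ∈ A <;> simp [h]

theorem trunc_trunc (A B : Set ℕ) (x : Ell1) : trunc A (trunc B x) = trunc (A ∩ B) x := by
  ext n
  simp only [trunc_apply]
  by_cases hA : n ∈ A <;> by_cases hB : n ∈ B <;> simp [hA, hB, trunc_apply]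

theorem trunc_add_trunc_compl (A : Set ℕ) (x : Ell1) : trunc A x + trunc Aᶜ x = x := by
  ext n
  by_cases h : n ∈ A <;> simp [trunc_apply, h]

theorem norm_trunc (A : Set ℕ) (x : Ell1) :
    ‖trunc A x‖ = ∑' n, A.indicator (fun n => ‖x n‖) n := by
  rw [norm_eq_tsum]
  congr 1
  ext n
  by_cases h : n ∈ A <;> simp [trunc_apply, h]

theorem norm_trunc_add_norm_trunc_compl (A : Set ℕ) (x : Ell1) :
    ‖trunc A x‖ + ‖trunc Aᶜ x‖ = ‖x‖ := by
  rw [norm_trunc, norm_trunc, norm_eq_tsum,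
    ← ((summable_norm x).indicator A).tsum_add ((summable_norm x).indicator Aᶜ)]
  congr 1
  ext n
  exact congrFun (Set.indicator_self_add_compl A fun n => ‖x n‖) n

theorem trunc_e (A : Set ℕ) (n : ℕ) : trunc A (e n) = A.indicator (1 : ℕ → ℂ) n • e n := by
  ext m
  rw [trunc_apply]
  rcases eq_or_ne m n with rfl | h
  · by_cases hA : m ∈ A <;> simp [hA]
  · by_cases hA : m ∈ A <;> simp [hA, h]

theorem tendsto_trunc_Ici (x : Ell1) : Tendsto (fun N => trunc (Set.Ici N) x) atTop (𝓝 0) := by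
  rw [tendsto_zero_iff_norm_tendsto_zero]
  simp only [norm_trunc]
  have h := tendsto_tsum_of_dominated_convergence (𝓕 := (atTop : Filter ℕ))
    (f := fun N n => (Set.Ici N).indicator (fun n => ‖x n‖) n) (g := fun _ => (0 : ℝ))
    (summable_norm x) (fun n => ?_) (Eventually.of_forall fun N n => ?_)
  · simpa using h
  · refine tendsto_const_nhds.congr' ?_
    filter_upwards [eventually_gt_atTop n] with N hN
    rw [Set.indicator_of_notMem (by simpa using hN)]
  · by_cases h : n ∈ Set.Ici N <;> simp [h]

theorem summable_norm_mul (x y : Ell1) : Summable fun n => ‖x n * y n‖ := by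
  refine Summable.of_nonneg_of_le (fun _ => norm_nonneg _) (fun n => ?_)
    ((summable_norm x).mul_right ‖y‖)
  rw [norm_mul]
  gcongr
  exact lp.norm_apply_le_norm (by simp) y n

/-- The bilinear form `∑ xₙ yₙ` on `ℓ₁`. -/
noncomputable def dotForm : Ell1 →L[ℂ] Ell1 →L[ℂ] ℂ :=
  LinearMap.mkContinuous₂
    (LinearMap.mk₂ ℂ (fun x y : Ell1 => ∑' n, x n * y n)
      (fun x x' y => by
        rw [← (summable_norm_mul x y).of_norm.tsum_add (summable_norm_mul x' y).of_norm]
        simp [add_mul])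
      (fun c x y => by
        rw [smul_eq_mul, ← tsum_mul_left]
        simp [mul_assoc])
      (fun x y y' => by
        rw [← (summable_norm_mul x y).of_norm.tsum_add (summable_norm_mul x y').of_norm]
        simp [mul_add])
      (fun c x y => by
        rw [smul_eq_mul, ← tsum_mul_left]
        simp [mul_left_comm]))
    1 fun x y => by
      rw [one_mul, norm_eq_tsum x, ← tsum_mul_right]
      refine tsum_of_norm_bounded ((summable_norm x).mul_right ‖y‖).hasSum fun n => ?_
      rw [norm_mul]
      gcongr
      exact lp.norm_apply_le_norm (by simp) y n

theorem dotForm_apply (x y : Ell1) : dotForm x y = ∑' n, x n * y n := rfl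

theorem norm_dotForm_le (x y : Ell1) : ‖dotForm x y‖ ≤ ‖x‖ * ‖y‖ := by
  have h := dotForm.le_of_opNorm₂_le_of_le (LinearMap.mkContinuous₂_norm_le _ zero_le_one _)
    (le_refl ‖x‖) (le_refl ‖y‖)
  simpa using h

theorem dotForm_comm (x y : Ell1) : dotForm x y = dotForm y x := by
  simp only [dotForm_apply, mul_comm]

theorem dotForm_e (x : Ell1) (n : ℕ) : dotForm x (e n) = x n := by
  rw [dotForm_apply, tsum_eq_single n]
  · simp
  · intro m hm
    simp [hm]

theorem tendsto_coord (x : Ell1) : Tendsto (fun n => x n) atTop (𝓝 0) :=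
  (summable_norm x).of_norm.tendsto_atTop_zero

end Ell1

/-! ### Extreme points of the balls of `c₀^⊥` -/

section Extreme

/-- The functional `y ↦ ω (1_A y)`, where `ℓ₁'` is seen as the space of bounded sequences. -/
noncomputable def restrict (ω : Bidual Ell1) (A : Set ℕ) : Bidual Ell1 :=
  ω.comp ((ContinuousLinearMap.compL ℂ Ell1 Ell1 ℂ).flip (trunc A))

theorem restrict_apply (ω : Bidual Ell1) (A : Set ℕ) (y : StrongDual ℂ Ell1) :
    restrict ω A y = ω (y.comp (trunc A)) := rfl

theorem restrict_restrict (ω : Bidual Ell1) (A B : Set ℕ) :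
    restrict (restrict ω A) B = restrict ω (A ∩ B) := by
  ext y
  simp only [restrict_apply]
  congr 1
  ext x
  simp [trunc_trunc, Set.inter_comm]

theorem restrict_smul (c : ℝ) (ω : Bidual Ell1) (A : Set ℕ) :
    restrict (c • ω) A = c • restrict ω A := rfl

theorem restrict_empty (ω : Bidual Ell1) : restrict ω ∅ = 0 := by
  ext y
  rw [restrict_apply]
  have : y.comp (trunc ∅) = 0 := by
    ext x
    have h : trunc ∅ x = 0 := by
      ext n
      simp [trunc_apply]
    simp [h]
  rw [this, map_zero]
  rfl

theorem restrict_add_restrict_compl (ω : Bidual Ell1) (A : Set ℕ) :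
    restrict ω A + restrict ω Aᶜ = ω := by
  ext y
  rw [add_apply, restrict_apply, restrict_apply, ← map_add]
  congr 1
  ext x
  simp only [add_apply, ContinuousLinearMap.comp_apply]
  rw [← map_add, trunc_add_trunc_compl]

theorem restrict_mem_c0Perp {ω : Bidual Ell1} (hω : ω ∈ c0Perp) (A : Set ℕ) :
    restrict ω A ∈ c0Perp := by
  intro y hy
  refine hω _ (squeeze_zero_norm (fun n => ?_) (tendsto_zero_iff_norm_tendsto_zero.1 hy))
  change ‖y (trunc A (e n))‖ ≤ ‖y (e n)‖
  rw [trunc_e]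
  by_cases h : n ∈ A <;> simp [h]

theorem inv_norm_smul_mem_closedBall {X : Type*} [NormedAddCommGroup X] [NormedSpace ℂ X]
    {w : Bidual X} (hw : 0 < ‖w‖) : ‖w‖⁻¹ • w ∈ Metric.closedBall (0 : Bidual X) 1 := by
  have h : ‖w‖⁻¹ • w = ((‖w‖⁻¹ : ℝ) : ℂ) • w := by
    ext y
    simp
  have hn : ‖((‖w‖⁻¹ : ℝ) : ℂ) • w‖ ≤ 1 := by
    refine (ContinuousLinearMap.opNorm_smul_le _ w).trans ?_
    rw [Complex.norm_real, Real.norm_of_nonneg (by positivity), inv_mul_cancel₀ hw.ne']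
  rw [h]
  exact (dist_zero_right (((‖w‖⁻¹ : ℝ) : ℂ) • w)).trans_le hn

theorem real_smul_mem_c0Perp (r : ℝ) {ω : Bidual Ell1} (hω : ω ∈ c0Perp) : r • ω ∈ c0Perp := by
  have h : r • ω = (r : ℂ) • ω := by
    ext y
    simp
  rw [h]
  exact c0Perp.smul_mem (r : ℂ) hω

/-- The bidual norm is additive over complementary sets of indices. -/
theorem norm_restrict_add_norm_restrict_compl_le (ω : Bidual Ell1) (A : Set ℕ) :
    ‖restrict ω A‖ + ‖restrict ω Aᶜ‖ ≤ ‖ω‖ := by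
  by_contra! hlt
  set η := (‖restrict ω A‖ + ‖restrict ω Aᶜ‖ - ‖ω‖) / 2 with hη
  have hη0 : 0 < η := by linarith
  obtain ⟨y₁, hy₁, h₁⟩ := (restrict ω A).exists_lt_apply_of_lt_opNorm
    (show ‖restrict ω A‖ - η < ‖restrict ω A‖ by linarith)
  obtain ⟨y₂, hy₂, h₂⟩ := (restrict ω Aᶜ).exists_lt_apply_of_lt_opNorm
    (show ‖restrict ω Aᶜ‖ - η < ‖restrict ω Aᶜ‖ by linarith)
  obtain ⟨c₁, hc₁, hcy₁⟩ := RCLike.exists_norm_eq_mul_self (restrict ω A y₁)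
  obtain ⟨c₂, hc₂, hcy₂⟩ := RCLike.exists_norm_eq_mul_self (restrict ω Aᶜ y₂)
  let y : StrongDual ℂ Ell1 := c₁ • y₁.comp (trunc A) + c₂ • y₂.comp (trunc Aᶜ)
  have hy : ‖y‖ ≤ 1 := by
    refine y.opNorm_le_bound zero_le_one fun x => ?_
    have hx := norm_trunc_add_norm_trunc_compl A x
    have h3 := y₁.le_opNorm (trunc A x)
    have h4 := y₂.le_opNorm (trunc Aᶜ x)
    calc ‖y x‖ ≤ ‖c₁ * y₁ (trunc A x)‖ + ‖c₂ * y₂ (trunc Aᶜ x)‖ := norm_add_le _ _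
      _ ≤ 1 * ‖x‖ := by
        rw [norm_mul, norm_mul, hc₁, hc₂]
        nlinarith [norm_nonneg (trunc A x), norm_nonneg (trunc Aᶜ x)]
  have hval : ω y = ((‖restrict ω A y₁‖ + ‖restrict ω Aᶜ y₂‖ : ℝ) : ℂ) := by
    have : ω y = c₁ * restrict ω A y₁ + c₂ * restrict ω Aᶜ y₂ := by
      simp [y, restrict_apply]
    rw [this]
    push_cast
    rw [← hcy₁, ← hcy₂]
    rfl
  have hle : ‖ω y‖ ≤ ‖ω‖ := by
    simpa using ω.le_opNorm_of_le hy
  rw [hval, Complex.norm_real, Real.norm_of_nonneg (by positivity)] at hle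
  linarith

/-- Otherwise the decomposition `ω = ω 1_A + ω 1_{Aᶜ}`, with both parts rescaled to the norm of
`ω`, would show `ω` as an interior point of a segment. -/
theorem restrict_eq_zero_or_of_extreme {ω : Bidual Ell1}
    (hω : ω ∈ Set.extremePoints ℝ
      (‖ω‖ • ((c0Perp : Set (Bidual Ell1)) ∩ Metric.closedBall (0 : Bidual Ell1) 1)))
    (hmem : ω ∈ c0Perp) (A : Set ℕ) : restrict ω A = 0 ∨ restrict ω Aᶜ = 0 := by
  by_contra! hne
  obtain ⟨hA, hAc⟩ := hne
  have ha := (norm_pos_iff (a := restrict ω A)).2 hA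
  have hb := (norm_pos_iff (a := restrict ω Aᶜ)).2 hAc
  have hsum : ‖restrict ω A‖ + ‖restrict ω Aᶜ‖ = ‖ω‖ := by
    refine le_antisymm (norm_restrict_add_norm_restrict_compl_le ω A) ?_
    conv_lhs => rw [← restrict_add_restrict_compl ω A]
    exact norm_add_le (restrict ω A) (restrict ω Aᶜ)
  have hR : 0 < ‖ω‖ := by linarith
  have key : ∀ B : Set ℕ, 0 < ‖restrict ω B‖ → (‖ω‖ * ‖restrict ω B‖⁻¹) • restrict ω B ∈
      ‖ω‖ • ((c0Perp : Set (Bidual Ell1)) ∩ Metric.closedBall (0 : Bidual Ell1) 1) := by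
    intro B hB
    rw [mul_smul]
    refine Set.smul_mem_smul_set ⟨?_, ?_⟩
    · exact real_smul_mem_c0Perp _ (restrict_mem_c0Perp hmem B)
    · exact inv_norm_smul_mem_closedBall hB
  have hseg : ω ∈ openSegment ℝ ((‖ω‖ * ‖restrict ω A‖⁻¹) • restrict ω A)
      ((‖ω‖ * ‖restrict ω Aᶜ‖⁻¹) • restrict ω Aᶜ) := by
    refine ⟨‖restrict ω A‖ / ‖ω‖, ‖restrict ω Aᶜ‖ / ‖ω‖, by positivity, by positivity, ?_, ?_⟩
    · rw [← add_div, hsum, div_self hR.ne']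
    · rw [smul_smul, smul_smul]
      have h : ∀ t : ℝ, 0 < t → t / ‖ω‖ * (‖ω‖ * t⁻¹) = 1 := fun t ht => by
        field_simp
      rw [h _ ha, h _ hb, one_smul, one_smul, restrict_add_restrict_compl]
  have heq : (‖ω‖ * ‖restrict ω A‖⁻¹) • restrict ω A = ω :=
    (mem_extremePoints.1 hω).2 _ (key A ha) _ (key Aᶜ hb) hseg |>.1
  -- The left side vanishes on sequences supported off `A`.
  apply hAc
  rw [← heq, restrict_smul, restrict_restrict, Set.inter_compl_self, restrict_empty]
  ext y
  simp

/-- The sets that carry an extreme point form an ultrafilter. -/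
theorem exists_ultrafilter_restrict_eq {ω : Bidual Ell1} (h0 : ω ≠ 0)
    (h : ∀ A : Set ℕ, restrict ω A = 0 ∨ restrict ω Aᶜ = 0) :
    ∃ u : Ultrafilter ℕ, ∀ A ∈ u, restrict ω A = ω := by
  let F : Filter ℕ :=
    { sets := {A | restrict ω A = ω}
      univ_sets := by
        have := restrict_add_restrict_compl ω Set.univ
        rwa [Set.compl_univ, restrict_empty, add_zero] at this
      sets_of_superset := by
        intro A B hA hAB
        change restrict ω B = ω
        rw [← hA, restrict_restrict, Set.inter_eq_left.2 hAB]
      inter_sets := by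
        intro A B hA hB
        change restrict ω (A ∩ B) = ω
        rw [← restrict_restrict, hA, hB] }
  have hF : ∀ A, A ∈ F ↔ restrict ω A = ω := fun A => Iff.rfl
  refine ⟨Ultrafilter.ofComplNotMemIff F fun A => ?_, fun A hA => hA⟩
  rw [hF, hF]
  have hadd := restrict_add_restrict_compl ω A
  constructor
  · intro hne
    rcases h A with h1 | h1
    · rw [h1, zero_add] at hadd
      exact absurd hadd hne
    · rwa [h1, add_zero] at hadd
  · intro h1 h2
    apply h0
    rw [← h1, ← h2, restrict_restrict, Set.compl_inter_self, restrict_empty]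

/-- An extreme point of a ball of `c₀^⊥` is a multiple of the limit along a free ultrafilter. -/
theorem exists_ultrafilter_of_extreme {ω : Bidual Ell1} (h0 : ω ≠ 0)
    (hω : ω ∈ Set.extremePoints ℝ
      (‖ω‖ • ((c0Perp : Set (Bidual Ell1)) ∩ Metric.closedBall (0 : Bidual Ell1) 1))) :
    ∃ (u : Ultrafilter ℕ) (c : ℂ), (u : Filter ℕ) ≤ atTop ∧ ‖c‖ = ‖ω‖ ∧
      ∀ y : StrongDual ℂ Ell1, Tendsto (fun n => c * y (e n)) u (𝓝 (ω y)) := by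
  have hmem : ω ∈ c0Perp := by
    obtain ⟨w, hw, hwω⟩ := hω.1
    rw [← hwω]
    exact real_smul_mem_c0Perp _ hw.1
  obtain ⟨u, hu⟩ := exists_ultrafilter_restrict_eq h0 (restrict_eq_zero_or_of_extreme hω hmem)
  have hlim : ∀ y : StrongDual ℂ Ell1, ∃ l, ‖l‖ ≤ ‖y‖ ∧ Tendsto (fun n => y (e n)) u (𝓝 l) ∧
      ω y = ω total * l := by
    intro y
    obtain ⟨l, hl, hlt⟩ := exists_tendsto_ultrafilter_of_norm_le u (F := fun n => y (e n))
      (Eventually.of_forall (norm_apply_e_le y))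
    refine ⟨l, hl, hlt, ?_⟩
    rw [← sub_eq_zero, ← norm_le_zero_iff]
    refine le_of_forall_pos_le_add fun ε hε => ?_
    -- `ω` is carried by the set of indices where `y` is close to its limit.
    set ε' := ε / (‖ω‖ + 1)
    have hε' : 0 < ε' := by positivity
    set A : Set ℕ := {n | ‖y (e n) - l‖ < ε'} with hA
    have hAu : A ∈ u := by
      have := Metric.tendsto_nhds.1 hlt ε' hε'
      simp only [dist_eq_norm] at this
      exact this
    have hval : ω y - ω total * l = ω ((y - l • total).comp (trunc A)) := by
      rw [← restrict_apply, hu A hAu, map_sub, map_smul, smul_eq_mul, mul_comm l]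
    have hn : ‖(y - l • total).comp (trunc A)‖ ≤ ε' := by
      refine opNorm_le_of_forall_e hε'.le fun n => ?_
      rw [ContinuousLinearMap.comp_apply, trunc_e]
      by_cases hn : n ∈ A
      · have hn' : ‖y (e n) - l‖ < ε' := hn
        simpa [hn, total_e] using hn'.le
      · simpa [hn] using hε'.le
    rw [hval, zero_add]
    refine (ω.le_opNorm_of_le hn).trans ?_
    rw [mul_div_assoc', div_le_iff₀ (by positivity)]
    nlinarith [norm_nonneg ω]
  have hc : ‖ω total‖ = ‖ω‖ := by
    refine le_antisymm ?_ (ω.opNorm_le_bound (norm_nonneg _) fun y => ?_)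
    · have : ‖total‖ ≤ 1 := total.opNorm_le_bound zero_le_one fun x => by
        simpa using norm_total_le x
      simpa using ω.le_opNorm_of_le this
    · obtain ⟨l, hl, -, hy⟩ := hlim y
      rw [hy, norm_mul]
      gcongr
  refine ⟨u, ω total, ?_, hc, fun y => ?_⟩
  -- `u` is free: a finite set carries no nonzero functional that vanishes on `c₀`.
  · rw [atTop_basis.ge_iff]
    intro N _
    by_contra hN
    have hN' : (Set.Ici N)ᶜ ∈ u := Ultrafilter.compl_mem_iff_notMem.2 hN
    have h1 : ω (total.comp (trunc (Set.Ici N)ᶜ)) = 0 := by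
      refine hmem _ (tendsto_const_nhds.congr' ?_)
      filter_upwards [eventually_ge_atTop N] with n hn
      change 0 = total (trunc _ (e n))
      rw [trunc_e]
      simp [hn]
    rw [← restrict_apply, hu _ hN'] at h1
    rw [h1, norm_zero] at hc
    exact h0 ((norm_eq_zero (a := ω)).1 hc.symm)
  · obtain ⟨l, -, hlt, hy⟩ := hlim y
    rw [hy]
    exact hlt.const_mul _

end Extreme

/-! ### Separating quadratic polynomials -/

section Separation

/-- The functional `∑_{i < N} sᵢ xᵢ`. -/
noncomputable def head (s : ℕ → ℂ) (hs : ∀ n, ‖s n‖ ≤ 1) (N : ℕ) : StrongDual ℂ Ell1 :=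
  total.comp ((diag s hs).comp (trunc (Set.Iio N)))

/-- The functional `t ∑_{i ≥ N} xᵢ`. -/
noncomputable def tail (t : ℂ) (N : ℕ) : StrongDual ℂ Ell1 := t • total.comp (trunc (Set.Ici N))

/-- The bilinear form `∑_{i ≥ N} xᵢ yᵢ`. -/
noncomputable def tailForm (N : ℕ) : Ell1 →L[ℂ] Ell1 →L[ℂ] ℂ :=
  dotForm.bilinearComp (trunc (Set.Ici N)) (trunc (Set.Ici N))

theorem tailForm_apply (N : ℕ) (x y : Ell1) :
    tailForm N x y = dotForm (trunc (Set.Ici N) x) (trunc (Set.Ici N) y) := rfl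

theorem tailForm_e {N n : ℕ} (hn : N ≤ n) (x : Ell1) : tailForm N x (e n) = x n := by
  rw [tailForm_apply, trunc_e, Set.indicator_of_mem (Set.mem_Ici.2 hn), Pi.one_apply, one_smul,
    dotForm_e, trunc_apply, Set.indicator_of_mem (Set.mem_Ici.2 hn)]

theorem tailForm_comm (N : ℕ) (x y : Ell1) : tailForm N x y = tailForm N y x :=
  dotForm_comm _ _

theorem norm_head_apply_le (s : ℕ → ℂ) (hs : ∀ n, ‖s n‖ ≤ 1) (N : ℕ) (x : Ell1) :
    ‖head s hs N x‖ ≤ ‖trunc (Set.Iio N) x‖ :=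
  (norm_total_le _).trans (norm_diag_le s hs _)

theorem norm_tail_apply_le {t : ℂ} (ht : ‖t‖ = 1) (N : ℕ) (x : Ell1) :
    ‖tail t N x‖ ≤ ‖trunc (Set.Ici N) x‖ := by
  rw [tail, smul_apply, norm_smul, ht, one_mul]
  exact norm_total_le _

theorem norm_tailForm_le (N : ℕ) (x : Ell1) : ‖tailForm N x x‖ ≤ ‖trunc (Set.Ici N) x‖ ^ 2 := by
  rw [sq]
  exact norm_dotForm_le _ _

theorem norm_trunc_Iio_add (N : ℕ) (x : Ell1) :
    ‖trunc (Set.Iio N) x‖ + ‖trunc (Set.Ici N) x‖ = ‖x‖ := by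
  rw [← Set.compl_Iio, norm_trunc_add_norm_trunc_compl]

theorem head_e_eq_zero (s : ℕ → ℂ) (hs : ∀ n, ‖s n‖ ≤ 1) {N n : ℕ} (hn : N ≤ n) :
    head s hs N (e n) = 0 := by
  rw [head, ContinuousLinearMap.comp_apply, ContinuousLinearMap.comp_apply, trunc_e,
    Set.indicator_of_notMem (by simpa using hn), zero_smul, map_zero, map_zero]

theorem tail_e (t : ℂ) {N n : ℕ} (hn : N ≤ n) : tail t N (e n) = t := by
  rw [tail, smul_apply, ContinuousLinearMap.comp_apply, trunc_e,
    Set.indicator_of_mem (Set.mem_Ici.2 hn), Pi.one_apply, one_smul, total_e, smul_eq_mul, mul_one]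

theorem head_apply_of_phase {s : ℕ → ℂ} (hs : ∀ n, ‖s n‖ ≤ 1) {z : Ell1}
    (hsz : ∀ n, s n * z n = ‖z n‖) (N : ℕ) :
    head s hs N z = (‖trunc (Set.Iio N) z‖ : ℂ) := by
  rw [head, ContinuousLinearMap.comp_apply, ContinuousLinearMap.comp_apply, total_apply,
    norm_eq_tsum, Complex.ofReal_tsum]
  congr 1
  ext n
  rw [diag_apply, trunc_apply]
  by_cases h : n ∈ Set.Iio N
  · rw [Set.indicator_of_mem h, hsz]
  · simp [Set.indicator_of_notMem h]

theorem tendsto_norm_trunc_Iio (z : Ell1) :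
    Tendsto (fun N => ‖trunc (Set.Iio N) z‖) atTop (𝓝 ‖z‖) := by
  have h := (tendsto_trunc_Ici z).norm.const_sub ‖z‖
  rw [norm_zero, sub_zero] at h
  refine h.congr fun N => ?_
  linarith [norm_trunc_Iio_add N z]

/-- With `h = head s N`, `l = tail t N` the quadratic polynomial `h² + 2 h l + t² ∑_{i ≥ N} xᵢ²`.
It arises from `(h + l)²`, of norm at most one, by omitting the mixed products of the coordinates after
`N`. -/
noncomputable def testFunction (s : ℕ → ℂ) (hs : ∀ n, ‖s n‖ ≤ 1) (t : ℂ) (N : ℕ) : Au Ell1 :=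
  ofDual (head s hs N) * ofDual (head s hs N) +
    (2 : ℂ) • (ofDual (head s hs N) * ofDual (tail t N)) + (t ^ 2) • ofBilin (tailForm N)

theorem norm_testFunction_le (s : ℕ → ℂ) (hs : ∀ n, ‖s n‖ ≤ 1) {t : ℂ} (ht : ‖t‖ = 1) (N : ℕ) :
    ‖testFunction s hs t N‖ ≤ 1 := by
  refine norm_le_of_forall_ball zero_le_one fun x hx => ?_
  have hval : zeroExtension (testFunction s hs t N) x = head s hs N x * head s hs N x +
      2 * (head s hs N x * tail t N x) + t ^ 2 * tailForm N x x := by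
    rw [zeroExtension_apply _ hx]
    rfl
  have hx1 : ‖x‖ ≤ 1 := (mem_ball_zero_iff.1 hx).le
  have h1 := norm_head_apply_le s hs N x
  have h2 := norm_tail_apply_le ht N x
  have h3 := norm_tailForm_le N x
  have h4 := norm_trunc_Iio_add N x
  rw [hval]
  set a := ‖trunc (Set.Iio N) x‖
  set b := ‖trunc (Set.Ici N) x‖
  calc _ ≤ ‖head s hs N x * head s hs N x‖ + ‖2 * (head s hs N x * tail t N x)‖ +
        ‖t ^ 2 * tailForm N x x‖ := norm_add₃_le
    _ ≤ a * a + 2 * (a * b) + b ^ 2 := by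
        rw [norm_mul, norm_mul, norm_mul, norm_mul, norm_pow, ht, one_pow, one_mul,
          Complex.norm_ofNat]
        gcongr
    _ = ‖x‖ ^ 2 := by rw [← h4]; ring
    _ ≤ 1 := pow_le_one₀ (norm_nonneg _) hx1

theorem apply_testFunction {χ : Spectrum Ell1} {w : Bidual Ell1} (hχ : χ ∈ fiber w) (s : ℕ → ℂ)
    (hs : ∀ n, ‖s n‖ ≤ 1) (t : ℂ) (N : ℕ) :
    χ (testFunction s hs t N) = w (head s hs N) * w (head s hs N) +
      2 * (w (head s hs N) * w (tail t N)) + t ^ 2 * χ (ofBilin (tailForm N)) := by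
  simp only [testFunction, map_add, map_mul, map_smul, smul_eq_mul, hχ _]

end Separation

/-! ### Limits of unit vectors -/

section Limit

variable {z : Ell1} {ω : Bidual Ell1} {u : Ultrafilter ℕ} {c : ℂ}

theorem apply_head_eq_zero (hu : (u : Filter ℕ) ≤ atTop)
    (hω : ∀ y : StrongDual ℂ Ell1, Tendsto (fun n => c * y (e n)) u (𝓝 (ω y)))
    (s : ℕ → ℂ) (hs : ∀ n, ‖s n‖ ≤ 1) (N : ℕ) : ω (head s hs N) = 0 := by
  refine tendsto_nhds_unique (hω _) (tendsto_const_nhds.congr' ?_)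
  filter_upwards [hu (eventually_ge_atTop N)] with n hn
  rw [head_e_eq_zero s hs hn, mul_zero]

theorem apply_tail (hu : (u : Filter ℕ) ≤ atTop)
    (hω : ∀ y : StrongDual ℂ Ell1, Tendsto (fun n => c * y (e n)) u (𝓝 (ω y)))
    (t : ℂ) (N : ℕ) : ω (tail t N) = c * t := by
  refine tendsto_nhds_unique (hω _) (tendsto_const_nhds.congr' ?_)
  filter_upwards [hu (eventually_ge_atTop N)] with n hn
  rw [tail_e t hn]

theorem apply_tailForm_eq_zero (hu : (u : Filter ℕ) ≤ atTop)
    (hω : ∀ y : StrongDual ℂ Ell1, Tendsto (fun n => c * y (e n)) u (𝓝 (ω y)))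
    (N : ℕ) (x : Ell1) : ω (tailForm N x) = 0 := by
  refine tendsto_nhds_unique (hω _) ?_
  have h := ((tendsto_coord x).mono_left hu).const_mul c
  rw [mul_zero] at h
  refine h.congr' ?_
  filter_upwards [hu (eventually_ge_atTop N)] with n hn
  rw [tailForm_e hn]

/-- On `ℓ₁ + c₀^⊥` the value of the canonical extension of the tail form at `z + ω` depends on `z`
only. -/
theorem multilinearExtension_tailForm (hu : (u : Filter ℕ) ≤ atTop)
    (hω : ∀ y : StrongDual ℂ Ell1, Tendsto (fun n => c * y (e n)) u (𝓝 (ω y))) (N : ℕ) :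
    multilinearExtension (NormedSpace.inclusionInDoubleDual ℂ Ell1 z + ω) 2
      (bilinForm (tailForm N)) = tailForm N z z := by
  rw [multilinearExtension_bilinForm]
  have h : (NormedSpace.inclusionInDoubleDual ℂ Ell1 z + ω).comp (tailForm N) = tailForm N z := by
    ext x
    rw [ContinuousLinearMap.comp_apply, add_apply, NormedSpace.dual_def,
      apply_tailForm_eq_zero hu hω, add_zero, tailForm_comm]
  rw [h, add_apply, NormedSpace.dual_def, apply_tailForm_eq_zero hu hω, add_zero]

/-- Along the points `z + c eₙ` the tail form has an additional contribution from the diagonal. -/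
theorem tendsto_tailForm (hu : (u : Filter ℕ) ≤ atTop) (N : ℕ) :
    Tendsto (fun x => tailForm N x x) (u.map fun n => z + c • e n)
      (𝓝 (tailForm N z z + c ^ 2)) := by
  rw [Ultrafilter.coe_map, tendsto_map'_iff]
  have h := (((tendsto_coord z).mono_left hu).const_mul (2 * c)).const_add
    (tailForm N z z + c ^ 2)
  rw [mul_zero, add_zero] at h
  refine h.congr' ?_
  filter_upwards [hu (eventually_ge_atTop N)] with n hn
  have h1 := tailForm_e hn z
  have h2 := tailForm_e hn (e n)
  have h3 : (e n : Ell1) n = 1 := by simp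
  rw [h3] at h2
  simp only [Function.comp_apply, map_add, map_smul, add_apply, smul_apply, smul_eq_mul]
  rw [tailForm_comm N (e n) z, h1, h2]
  ring

theorem tendsto_dual (hω : ∀ y : StrongDual ℂ Ell1, Tendsto (fun n => c * y (e n)) u (𝓝 (ω y)))
    (y : StrongDual ℂ Ell1) :
    Tendsto y (u.map fun n => z + c • e n)
      (𝓝 ((NormedSpace.inclusionInDoubleDual ℂ Ell1 z + ω) y)) := by
  rw [Ultrafilter.coe_map, tendsto_map'_iff, add_apply, NormedSpace.dual_def]
  refine ((hω y).const_add (y z)).congr fun n => ?_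
  simp

theorem exists_phase (w : ℂ) : ∃ t : ℂ, ‖t‖ = 1 ∧ t * w = ‖w‖ := by
  obtain ⟨t, ht, h⟩ := RCLike.exists_norm_eq_mul_self w
  exact ⟨t, ht, h.symm⟩

/-- The norm of the bidual is additive on `ℓ₁ + c₀^⊥`. -/
theorem norm_add_norm_le (hu : (u : Filter ℕ) ≤ atTop)
    (hω : ∀ y : StrongDual ℂ Ell1, Tendsto (fun n => c * y (e n)) u (𝓝 (ω y))) :
    ‖z‖ + ‖c‖ ≤ ‖NormedSpace.inclusionInDoubleDual ℂ Ell1 z + ω‖ := by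
  choose s hs1 hsz using fun n => exists_phase (z n)
  obtain ⟨t, ht, htc⟩ := exists_phase c
  have hs : ∀ n, ‖s n‖ ≤ 1 := fun n => (hs1 n).le
  have hb : ∀ N, ‖trunc (Set.Iio N) z‖ + ‖c‖ - ‖trunc (Set.Ici N) z‖ ≤
      ‖NormedSpace.inclusionInDoubleDual ℂ Ell1 z + ω‖ := by
    intro N
    -- `z + ω` is tested on a functional of norm at most one.
    have hn : ‖head s hs N + tail t N‖ ≤ 1 := by
      refine ContinuousLinearMap.opNorm_le_bound _ zero_le_one fun x => ?_
      rw [one_mul, ← norm_trunc_Iio_add N x]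
      exact (norm_add_le _ _).trans
        (add_le_add (norm_head_apply_le s hs N x) (norm_tail_apply_le ht N x))
    have h := (NormedSpace.inclusionInDoubleDual ℂ Ell1 z + ω).le_opNorm_of_le hn
    rw [mul_one, add_apply, NormedSpace.dual_def, map_add, apply_head_eq_zero hu hω,
      apply_tail hu hω, zero_add, mul_comm c, htc, add_apply, head_apply_of_phase hs hsz] at h
    have h5 := norm_tail_apply_le ht N z
    have h6 : ((‖trunc (Set.Iio N) z‖ + ‖c‖ : ℝ) : ℂ) =
        ((‖trunc (Set.Iio N) z‖ : ℂ) + tail t N z + ‖c‖) - tail t N z := by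
      push_cast
      ring
    have h7 : ‖trunc (Set.Iio N) z‖ + ‖c‖ ≤
        ‖(‖trunc (Set.Iio N) z‖ : ℂ) + tail t N z + ‖c‖‖ + ‖tail t N z‖ := by
      calc _ = ‖((‖trunc (Set.Iio N) z‖ + ‖c‖ : ℝ) : ℂ)‖ := by
            rw [Complex.norm_real, Real.norm_of_nonneg (by positivity)]
        _ ≤ _ := by
            rw [h6]
            exact norm_sub_le _ _
    linarith
  have hlim := ((tendsto_norm_trunc_Iio z).add_const ‖c‖).sub (tendsto_trunc_Ici z).norm
  rw [norm_zero, sub_zero] at hlim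
  exact le_of_tendsto' hlim hb

end Limit

end AuSpectrum

open Filter AuSpectrum in
theorem mainTheorem5
    (z : AuSpectrum.Ell1) (hz : z ∈ Metric.ball (0 : AuSpectrum.Ell1) 1)
    (ω : AuSpectrum.Bidual AuSpectrum.Ell1)
    (hω : ω ∈ Set.extremePoints ℝ
      (‖ω‖ • ((AuSpectrum.c0Perp : Set (AuSpectrum.Bidual AuSpectrum.Ell1)) ∩
        Metric.closedBall (0 : AuSpectrum.Bidual AuSpectrum.Ell1) 1)))
    (z'' : AuSpectrum.Bidual AuSpectrum.Ell1)
    (hz'' : z'' = NormedSpace.inclusionInDoubleDual ℂ AuSpectrum.Ell1 z + ω)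
    (hsphere : z'' ∈ Metric.sphere (0 : AuSpectrum.Bidual AuSpectrum.Ell1) 1) :
    ∃ δ ∈ AuSpectrum.fiber z'',
      (∀ f : AuSpectrum.Au AuSpectrum.Ell1, δ f = AuSpectrum.canonicalExtension f z'') ∧
      ∃ φ ∈ AuSpectrum.fiber z'',
        AuSpectrum.gleasonPart φ ≠ AuSpectrum.gleasonPart δ := by
  have hz1 : ‖z‖ < 1 := mem_ball_zero_iff.1 hz
  have hn1 : ‖z''‖ = 1 := by
    have h : dist z'' 0 = 1 := hsphere
    exact (dist_zero_right z'').symm.trans h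
  have hωne : ω ≠ 0 := by
    rintro rfl
    rw [hz'', add_zero] at hn1
    linarith [NormedSpace.double_dual_bound ℂ Ell1 z]
  -- `ω` is `c` times the limit along a free ultrafilter, and `‖z‖ + |c| = 1`.
  obtain ⟨u, c, hu, hc, hlim⟩ := exists_ultrafilter_of_extreme hωne hω
  have hc0 : 0 < ‖c‖ := by
    rw [hc]
    exact (norm_pos_iff (a := ω)).2 hωne
  have hsum : ‖z‖ + ‖c‖ = 1 := by
    refine le_antisymm ?_ ?_
    · rw [← hn1, hz'']
      exact norm_add_norm_le hu hlim
    · rw [← hn1, hz'', hc]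
      exact (norm_add_le _ ω).trans
        (add_le_add (NormedSpace.double_dual_bound ℂ Ell1 z) le_rfl)
  set p : Ultrafilter Ell1 := u.map fun n => z + c • e n with hpdef
  have hp : ∀ᶠ x in (p : Filter Ell1), ‖x‖ ≤ 1 := by
    rw [hpdef, Ultrafilter.coe_map, eventually_map]
    refine Eventually.of_forall fun n => (norm_add_le _ _).trans ?_
    rw [norm_smul, norm_e, mul_one, hsum]
  have hpz : ∀ y : StrongDual ℂ Ell1, Tendsto y p (𝓝 (z'' y)) := by
    rw [hz'']
    exact tendsto_dual hlim
  have hq : ∀ᶠ x in (averageUltrafilter p : Filter Ell1), ‖x‖ ≤ 1 :=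
    eventually_norm_le_averageUltrafilter hp
  have hqz : ConvergesOnPolynomials (averageUltrafilter p) z'' := fun n A hA =>
    tendsto_averageUltrafilter hp hpz hA
  obtain ⟨φ, hφ⟩ := exists_isRadialLimit p hp
  obtain ⟨δ, hδ⟩ := exists_isRadialLimit (averageUltrafilter p) hq
  have hφz : φ ∈ fiber z'' := hφ.mem_fiber hp hpz
  have hδz : δ ∈ fiber z'' := hδ.mem_fiber hq hqz.tendsto_dual
  refine ⟨δ, hδz, hδ.apply_eq_canonicalExtension hq hqz, φ, hφz, fun heq => ?_⟩
  have hmem : φ ∈ gleasonPart δ := heq ▸ mem_gleasonPart_self φ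
  have hlt : ‖WeakDual.toStrongDual (δ : WeakDual ℂ (Au Ell1)) -
      WeakDual.toStrongDual (φ : WeakDual ℂ (Au Ell1))‖ < 2 := hmem
  -- The phases `s` and `t` make `testFunction` as large as possible at the points `z + c eₙ`.
  choose s hs1 hsz using fun n => exists_phase (z n)
  obtain ⟨t, ht, htc⟩ := exists_phase c
  have hs : ∀ n, ‖s n‖ ≤ 1 := fun n => (hs1 n).le
  have hhead : ∀ N, z'' (head s hs N) = (‖trunc (Set.Iio N) z‖ : ℂ) := fun N => by
    rw [hz'', add_apply, NormedSpace.dual_def, apply_head_eq_zero hu hlim, add_zero,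
      head_apply_of_phase hs hsz]
  have htail : ∀ N, z'' (tail t N) = tail t N z + ‖c‖ := fun N => by
    rw [hz'', add_apply, NormedSpace.dual_def, apply_tail hu hlim, mul_comm c, htc]
  -- The two characters differ only in their values at the tail form.
  have hφform : ∀ N, φ (ofBilin (tailForm N)) = tailForm N z z + c ^ 2 := fun N =>
    hφ.apply_ofBilin hp (tendsto_tailForm hu N)
  have hδform : ∀ N, δ (ofBilin (tailForm N)) = tailForm N z z := fun N => by
    have h := hqz 2 _ (isSymmetric_bilinForm (tailForm_comm N))
    rw [hz'', multilinearExtension_tailForm hu hlim] at h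
    exact hδ.apply_ofBilin hq h
  have hheadlim : Tendsto (fun N => (‖trunc (Set.Iio N) z‖ : ℂ)) atTop (𝓝 (‖z‖ : ℂ)) :=
    (Complex.continuous_ofReal.tendsto _).comp (tendsto_norm_trunc_Iio z)
  have htrunc0 : Tendsto (fun N => ‖trunc (Set.Ici N) z‖) atTop (𝓝 0) := by
    simpa using (tendsto_trunc_Ici z).norm
  have htaillim : Tendsto (fun N => tail t N z + (‖c‖ : ℂ)) atTop (𝓝 (0 + (‖c‖ : ℂ))) :=
    (squeeze_zero_norm (fun N => norm_tail_apply_le ht N z) htrunc0).add_const _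
  have hformlim : Tendsto (fun N => tailForm N z z) atTop (𝓝 0) :=
    squeeze_zero_norm (fun N => norm_tailForm_le N z) (by simpa using htrunc0.pow 2)
  -- With `hlead` the common part of the values of `φ` and `δ` tends to `‖z‖² + 2 ‖z‖ |c|`.
  have hlead := (hheadlim.mul hheadlim).add ((hheadlim.mul htaillim).const_mul 2)
  have hsumC : (‖z‖ : ℂ) + ‖c‖ = 1 := by exact_mod_cast hsum
  have htc2 : t ^ 2 * c ^ 2 = (‖c‖ : ℂ) ^ 2 := by rw [← mul_pow, htc]
  refine absurd hlt (not_lt.2 ?_)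
  refine two_le_norm_sub (fun N => norm_testFunction_le s hs ht N)
    (b := ((1 - ‖c‖ ^ 2 : ℝ) : ℂ)) ?_ ?_ ?_
  · have hc1 : ‖c‖ ≤ 1 := by linarith [norm_nonneg z]
    rw [Complex.norm_real, Real.norm_of_nonneg (by nlinarith)]
    nlinarith
  · have h := hlead.add ((hformlim.add_const (c ^ 2)).const_mul (t ^ 2))
    refine (h.congr fun N => ?_).trans (le_of_eq ?_)
    · rw [apply_testFunction hφz, hhead, htail, hφform]
    · congr 1
      linear_combination htc2 + ((‖z‖ : ℂ) + ‖c‖ + 1) * hsumC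
  · have h := hlead.add (hformlim.const_mul (t ^ 2))
    refine (h.congr fun N => ?_).trans (le_of_eq ?_)
    · rw [apply_testFunction hδz, hhead, htail, hδform]
    · congr 1
      push_cast
      linear_combination ((‖z‖ : ℂ) + ‖c‖ + 1) * hsumC
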